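/- **Trees.** A tree is a partially ordered set $(T,\preceq)$ in which every set $\{b: b\prec a\}$ is finite and linearly ordered; $\ell(a)=|\{b:b\prec a\}|$ is the level of $a$, $T(n)$ is the set of nodes of level $n$, and $T({<}n)$, $T({\le}n)$ are defined accordingly. An $\mathcal S$-tree is a countable finitely branching tree with finitely many nodes of level $0$, together with a set $\Sigma$ and a partial function $\mathcal S\colon T\times T^{<\omega}\times\Sigma\to T$ such that: if $\mathcal S(a,\bar p,c)$ is defined, then it is an immediate successor of $a$ and all entries of $\bar p$ have level $<\ell(a)$; $\mathcal S(a,\bar p,c)=\mathcal S(b,\bar q,d)$ implies $a=b$, $\bar p=\bar q$, $c=d$; every immediate successor of a node $a$ is of the form $\mathcal S(a,\bar p,c)$. An injection $F\colon T\to T$ is shape-preserving if nodes of equal level have images of equal level, $\mathcal S(F(a),F(\bar p),c)$ is defined and $\preceq F(\mathcal S(a,\bar p,c))$ whenever $\mathcal S(a,\bar p,c)$ is defined, and $a\preceq F(b)$ whenever $a\in T(0)$ and $a\preceq b$. Write $\tilde F(n)$ for the level of $F(a)$, $a\in T(n)$. $F$ skips level $m$ if $m\notin\tilde F[\omega]$,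 and skips only level $m$ if $\tilde F[\omega]=\omega\setminus\{m\}$. An $(\mathcal S,\mathcal M)$-tree is an $\mathcal S$-tree with a set $\mathcal M$ of shape-preserving functions such that 1. $\mathrm{Id}\in\mathcal M$, $\mathcal M$ is closed under composition, and whenever $F_i\in\mathcal M$ and $F_i\restriction_{T(\le i)}=F_{i+1}\restriction_{T(\le i)}$ for all $i\in\omega$, there is $F_\infty\in\mathcal M$ with $F_\infty\restriction_{T(\le i)}=F_i\restriction_{T(\le i)}$ for all $i$; 2. if $F\in\mathcal M$, $\tilde F(n)>0$ and $F$ skips level $\tilde F(n)-1$, then there are $F_1,F_2\in\mathcal M$ such that $F_2$ skips only level $\tilde F(n)-1$ and $F_2\circ F_1\restriction_{T(\le n)}=F\restriction_{T(\le n)}$; 3. for all $n<m$ there is $F\in\mathcal M$ skipping only level $m$ such that $F(b)=\mathcal S(b,\bar p,c)$ whenever $a\in T(n)$, $b\in T(m)$, and $\mathcal S(a,\bar p,c)$ is defined and $\preceq b$. Let $\mathcal{AM}^n_1(m)$ be the set of restrictions $f=F\restriction_{T(\le n)}$ of functions $F\in\mathcal M$ that are the identity on $T({<}n)$ and satisfy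 $\tilde F(n)=m$. Each such $f$ has a unique canonical extension $f^+\in\mathcal M$: it extends $f$ and skips no level $\ge m$. **Fat subtrees.** A fat subtree of height $n\in\omega+1$ is a sequence $\mathbf U=(u_i)_{i<n}$ for which there is a (necessarily unique) cut function $c_{\mathbf U}\colon\min(n+1,\omega)\to\omega$ with $c_{\mathbf U}(0)=0$ and $u_\ell\in\mathcal{AM}^{c_{\mathbf U}(\ell)}_1(c_{\mathbf U}(\ell+1)-1)$ for all $\ell<n$. For $X\subseteq T(c_{\mathbf U}(\ell))$ and $\ell\le k\le n$ let $\mathrm{lift}_{\mathbf U}(X,\ell,k)=X$ if $\ell=k$, and otherwise $\mathrm{lift}_{\mathbf U}(X,\ell,k)=\mathrm{lift}_{\mathbf U}(u_\ell^+[N],\ell+1,k)$, where $N$ is the set of immediate successors of nodes in $X$. Put $\mathrm{lift}_{\mathbf U}(\ell,k)=\mathrm{lift}_{\mathbf U}(T(c_{\mathbf U}(\ell)),\ell,k)$. For fat subtrees $\mathbf V,\mathbf U$ of heights $m,m'$ write $\mathbf V\le\mathbf U$ if there is $\varphi\colon\min(m+1,\omega)\to\min(m'+1,\omega)$ such that for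 every $\ell<m$ we have $c_{\mathbf V}(\ell)=c_{\mathbf U}(\varphi(\ell))$, $\varphi(\ell)\le\varphi(\ell+1)$ and $\mathrm{lift}_{\mathbf V}(\ell,\ell+1)\subseteq\mathrm{lift}_{\mathbf U}(\varphi(\ell),\varphi(\ell+1))$. Let $\mathcal R$ be the set of infinite fat subtrees (height $\omega$), with the Ellentuck topology generated by the sets $$[\mathbf x,\mathbf U]=\{\mathbf V\in\mathcal R:\mathbf V\le\mathbf U\text{ and }\mathbf x\text{ is an initial segment of }\mathbf V\}$$ for $\mathbf x$ a finite fat subtree and $\mathbf U\in\mathcal R$. Write $[n,\mathbf U]=[\mathbf U\restriction_n,\mathbf U]$. If $\mathbf x\le\mathbf U$, let $\mathrm{depth}_{\mathbf U}(\mathbf x)$ be the unique $n$ with $c_{\mathbf U}(n)=c_{\mathbf x}(|\mathbf x|)$; otherwise let it be $\omega$. A set $\mathcal X\subseteq\mathcal R$ is *Ramsey* if for every $[\mathbf x,\mathbf U]\ne\emptyset$ the depth of $\mathbf x$ in $\mathbf U$ is finite and there is $\mathbf U'\in[\mathrm{depth}_{\mathbf U}(\mathbf x),\mathbf U]$ with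 $[\mathbf x,\mathbf U']\subseteq\mathcal X$ or $[\mathbf x,\mathbf U']\cap\mathcal X=\emptyset$; it is *Ramsey null* if the second alternative can always be achieved. **Theorem 1.10 (Ellentuck theorem for fat subtrees).** Let $(T,\preceq,\Sigma,\mathcal S,\mathcal M)$ be an $(\mathcal S,\mathcal M)$-tree and let $\mathcal R$ be its space of infinite fat subtrees with the Ellentuck topology. Then every subset of $\mathcal R$ with the property of Baire (a symmetric difference of an open set and a meager set) is Ramsey, and every meager subset of $\mathcal R$ is Ramsey null. -/

import Mathlib

/-- The level of a node: the number of its strict predecessors. -/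
noncomputable def nodeLevel {T : Type*} [PartialOrder T] (a : T) : ℕ := (Set.Iio a).ncard

/-- An `S`-tree on the partially ordered set `T` with alphabet `A`. The partial successor operation
is `succOp`; the value `none` means that it is undefined. -/
structure STree (T A : Type*) [PartialOrder T] where
  finite_below : ∀ a : T, (Set.Iio a).Finite
  chain_below : ∀ a : T, IsChain (· ≤ ·) (Set.Iio a)
  countable_nodes : Countable T
  finite_branching : ∀ a : T, {b : T | a ⋖ b}.Finite
  finite_roots : {a : T | nodeLevel a = 0}.Finite
  succOp : T → List T → A → Option T
  succ_spec : ∀ a p c b, succOp a p c = some b → a ⋖ b ∧ ∀ q ∈ p, nodeLevel q < nodeLevel a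
  succ_inj : ∀ a p c b q d x, succOp a p c = some x → succOp b q d = some x →
    a = b ∧ p = q ∧ c = d
  succ_constr : ∀ a b, a ⋖ b → ∃ p c, succOp a p c = some b

/-- Shape-preserving functions `T → T` of an `S`-tree. -/
structure STree.IsShapePreserving {T A : Type*} [PartialOrder T] (τ : STree T A) (F : T → T) :
    Prop where
  injective : Function.Injective F
  level_preserving : ∀ a b, nodeLevel a = nodeLevel b → nodeLevel (F a) = nodeLevel (F b)
  weakly_succ_preserving : ∀ a p c b, τ.succOp a p c = some b →
    ∃ d, τ.succOp (F a) (p.map F) c = some d ∧ d ≤ F b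
  root_le : ∀ a b, nodeLevel a = 0 → a ≤ b → a ≤ F b

/-- `F` skips level `m`. -/
def SkipsLevel {T : Type*} [PartialOrder T] (F : T → T) (m : ℕ) : Prop :=
  m ∉ Set.range (fun a => nodeLevel (F a))

/-- `F` skips only level `m`: the set of levels met by its range is `ω \ {m}`. -/
def SkipsOnlyLevel {T : Type*} [PartialOrder T] (F : T → T) (m : ℕ) : Prop :=
  Set.range (fun a => nodeLevel (F a)) = {m}ᶜ

/-- An `(S, M)`-tree: an `S`-tree with a closed monoid `M` of shape-preserving functions which
admits decompositions and is closed for duplication. -/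
structure SMTree (T A : Type*) [PartialOrder T] extends STree T A where
  M : Set (T → T)
  shape_preserving : ∀ F ∈ M, toSTree.IsShapePreserving F
  id_mem : id ∈ M
  comp_mem : ∀ F ∈ M, ∀ G ∈ M, F ∘ G ∈ M
  limit_mem : ∀ F : ℕ → T → T, (∀ i, F i ∈ M) →
    (∀ i a, nodeLevel a ≤ i → F i a = F (i + 1) a) →
    ∃ G ∈ M, ∀ i a, nodeLevel a ≤ i → G a = F i a
  /-- Here `m + 1` is the common level of the images of the nodes of level `n`. -/
  decomposition : ∀ F ∈ M, ∀ n m : ℕ, (∃ a, nodeLevel a = n ∧ nodeLevel (F a) = m + 1) →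
    SkipsLevel F m →
    ∃ F₁ ∈ M, ∃ F₂ ∈ M, SkipsOnlyLevel F₂ m ∧ ∀ a, nodeLevel a ≤ n → F₂ (F₁ a) = F a
  duplication : ∀ n m : ℕ, n < m → ∃ F ∈ M, SkipsOnlyLevel F m ∧
    ∀ a b p c d, nodeLevel a = n → nodeLevel b = m → succOp a p c = some d → d ≤ b →
      succOp b p c = some (F b)

/-- The restriction of `F` to the nodes of level `< k`, as a partial function. -/
noncomputable def restrictBelow {T : Type*} [PartialOrder T] (F : T → T) (k : ℕ) : T → Option T :=
  fun a => if nodeLevel a < k then some (F a) else none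

namespace SMTree

variable {T A : Type*} [PartialOrder T]

/-- `M^n`: the functions in `M` that are the identity on the nodes of level `< n`. -/
def MFix (τ : SMTree T A) (n : ℕ) : Set (T → T) :=
  {F | F ∈ τ.M ∧ ∀ a, nodeLevel a < n → F a = a}

/-- `AM^n_k`: the restrictions to the levels `< n + k` of the functions in `M^n`. -/
def AMApprox (τ : SMTree T A) (n k : ℕ) : Set (T → Option T) :=
  {f | ∃ F ∈ τ.MFix n, f = restrictBelow F (n + k)}

/-- `AM^n_k(m)`: the members of `AM^n_k` that send level `n + k - 1` to level `m`. -/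
def AMApproxTo (τ : SMTree T A) (n k m : ℕ) : Set (T → Option T) :=
  {f | f ∈ τ.AMApprox n k ∧ ∃ a b, nodeLevel a + 1 = n + k ∧ f a = some b ∧ nodeLevel b = m}

/-- `G` is the canonical extension of the partial function `f` with domain the levels `≤ n`:
it lies in `M`, extends `f`, and skips no level from the image of level `n` on. -/
def IsCanonicalExtension (τ : SMTree T A) (f : T → Option T) (n : ℕ) (G : T → T) : Prop :=
  G ∈ τ.M ∧ restrictBelow G (n + 1) = f ∧
    ∀ a k, nodeLevel a = n → nodeLevel (G a) ≤ k → ∃ b, nodeLevel (G b) = k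

open Classical in
/-- The canonical extension `f⁺` (the last case never occurs for members of `AM`). -/
noncomputable def canonicalExtension (τ : SMTree T A) (f : T → Option T) (n : ℕ) : T → T :=
  if h : ∃ G, τ.IsCanonicalExtension f n G then h.choose else id

/-- `c` is a cut function of the sequence `u` of length `n`. -/
def IsCut (τ : SMTree T A) (n : ℕ∞) (u : ℕ → T → Option T) (c : ℕ → ℕ) : Prop :=
  c 0 = 0 ∧ ∀ i : ℕ, (i : ℕ∞) < n → ∃ m, c (i + 1) = m + 1 ∧ u i ∈ τ.AMApproxTo (c i) 1 m

/-- A fat subtree of height `n ∈ ω + 1`, i.e. a sequence of length `n` of partial functions which has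
a cut function. The sequence is padded by the empty partial function from index `n` on. -/
@[ext]
structure FatSubtree (τ : SMTree T A) (n : ℕ∞) where
  seq : ℕ → T → Option T
  seq_padding : ∀ i : ℕ, n ≤ (i : ℕ∞) → seq i = fun _ => none
  exists_cut : ∃ c, τ.IsCut n seq c

/-- The values of a cut function up to index `n` are unique. -/
theorem IsCut.unique {τ : SMTree T A} {n : ℕ∞} {u : ℕ → T → Option T} {c c' : ℕ → ℕ}
    (h : τ.IsCut n u c) (h' : τ.IsCut n u c') : ∀ i : ℕ, (i : ℕ∞) ≤ n → c i = c' i := by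
  intro i
  induction i with
  | zero => intro _; rw [h.1, h'.1]
  | succ i ih =>
    intro hi
    have hlt : (i : ℕ∞) < n := lt_of_lt_of_le (by exact_mod_cast Nat.lt_succ_self i) hi
    obtain ⟨m, hm, ⟨F, hF, hu⟩, a, b, ha, hab, hb⟩ := h.2 i hlt
    obtain ⟨m', hm', -, a', b', ha', hab', hb'⟩ := h'.2 i hlt
    have hc := ih hlt.le
    rw [hu] at hab hab'
    have e : F a = b := by
      unfold restrictBelow at hab; split_ifs at hab; exact Option.some.inj hab
    have e' : F a' = b' := by
      unfold restrictBelow at hab'; split_ifs at hab'; exact Option.some.inj hab'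
    have := (τ.shape_preserving F hF.1).level_preserving a a' (by omega)
    rw [e, e'] at this
    omega

namespace FatSubtree

variable {τ : SMTree T A}

/-- The cut function of a fat subtree of height `n` (used at indices `≤ n` only). -/
noncomputable def cut {n : ℕ∞} (U : τ.FatSubtree n) : ℕ → ℕ := U.exists_cut.choose

/-- The recursion defining lifts: lift a set of nodes of level `cut ℓ` by `j` levels of `U`. -/
noncomputable def liftSteps {n : ℕ∞} (U : τ.FatSubtree n) : ℕ → ℕ → Set T → Set T
  | 0, _, X => X
  | j + 1, ℓ, X =>
    U.liftSteps j (ℓ + 1) (τ.canonicalExtension (U.seq ℓ) (U.cut ℓ) '' {b | ∃ a ∈ X, a ⋖ b})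

/-- The lift to level `k` of the set of all nodes of level `cut ℓ`, for `ℓ ≤ k ≤ n`. -/
noncomputable def lift {n : ℕ∞} (U : τ.FatSubtree n) (ℓ k : ℕ) : Set T :=
  U.liftSteps (k - ℓ) ℓ {a | nodeLevel a = U.cut ℓ}

/-- The relation "`V` is a subtree of `U`" between fat subtrees of heights `m` and `m'`. The
inequality `φ ℓ ≤ φ (ℓ + 1)` says that the lift on the right-hand side is defined. -/
def IsSubtree {m m' : ℕ∞} (V : τ.FatSubtree m) (U : τ.FatSubtree m') : Prop :=
  ∃ φ : ℕ → ℕ, (∀ ℓ : ℕ, (ℓ : ℕ∞) ≤ m → (φ ℓ : ℕ∞) ≤ m') ∧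
    ∀ ℓ : ℕ, (ℓ : ℕ∞) < m →
      V.cut ℓ = U.cut (φ ℓ) ∧ φ ℓ ≤ φ (ℓ + 1) ∧ V.lift ℓ (ℓ + 1) ⊆ U.lift (φ ℓ) (φ (ℓ + 1))

/-- The restriction of an infinite fat subtree to its first `n` members. -/
noncomputable def truncate (U : τ.FatSubtree ⊤) (n : ℕ) : τ.FatSubtree n where
  seq i := if i < n then U.seq i else fun _ => none
  seq_padding i hi := if_neg (not_lt.mpr (by exact_mod_cast hi))
  exists_cut := by
    obtain ⟨c, h0, h⟩ := U.exists_cut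
    refine ⟨c, h0, fun i hi => ?_⟩
    have hn : i < n := by exact_mod_cast hi
    simpa only [hn, if_true] using h i (ENat.natCast_lt_top i)

/-- The basic open set `[x, U]`: the infinite fat subtrees of `U` with initial segment `x`. -/
def basic {k : ℕ} (x : τ.FatSubtree k) (U : τ.FatSubtree ⊤) : Set (τ.FatSubtree ⊤) :=
  {V | V.IsSubtree U ∧ ∀ i < k, V.seq i = x.seq i}

/-- The Ellentuck topology on the space of infinite fat subtrees. -/
instance ellentuckTopology : TopologicalSpace (τ.FatSubtree ⊤) :=
  TopologicalSpace.generateFrom {s | ∃ (k : ℕ) (x : τ.FatSubtree k) (U : τ.FatSubtree ⊤),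
    s = basic x U}

/-- The depth of `x` in `U`: the unique `n` with `U.cut n = x.cut k` if `x` is a subtree of `U`,
and `⊤` otherwise (the infimum of the empty set). -/
noncomputable def depth {k : ℕ} (U : τ.FatSubtree ⊤) (x : τ.FatSubtree k) : ℕ∞ :=
  sInf {d | x.IsSubtree U ∧ ∃ n : ℕ, d = n ∧ U.cut n = x.cut k}

/-- Ramsey sets of infinite fat subtrees. -/
def IsRamsey (X : Set (τ.FatSubtree ⊤)) : Prop :=
  ∀ (k : ℕ) (x : τ.FatSubtree k) (U : τ.FatSubtree ⊤), (basic x U).Nonempty →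
    ∃ n : ℕ, depth U x = n ∧ ∃ U' ∈ basic (U.truncate n) U,
      basic x U' ⊆ X ∨ basic x U' ∩ X = ∅

/-- Ramsey null sets of infinite fat subtrees. -/
def IsRamseyNull (X : Set (τ.FatSubtree ⊤)) : Prop :=
  ∀ (k : ℕ) (x : τ.FatSubtree k) (U : τ.FatSubtree ⊤), (basic x U).Nonempty →
    ∃ n : ℕ, depth U x = n ∧ ∃ U' ∈ basic (U.truncate n) U, basic x U' ∩ X = ∅

end FatSubtree

end SMTree

/-- The property of Baire: being the symmetric difference of an open set and a meager set. -/
def HasBaireProperty {X : Type*} [TopologicalSpace X] (s : Set X) : Prop :=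
  ∃ O N : Set X, IsOpen O ∧ IsMeagre N ∧ s = symmDiff O N

/-! An infinite fat subtree is an infinite path of edges between cut levels, an edge being a member
of some $\mathcal{AM}^c_1(m)$ with source $c$ and target $m+1$. The relation $\mathbf V\le\mathbf U$
says that each edge of $\mathbf V$ is spanned by a segment of $\mathbf U$. For abstract path systems
with finitely many edges between two cut points, the Ellentuck theorem follows by combinatorial
forcing and fusion from a one-step pigeonhole principle (`PathSystem.Pigeonhole`): for every set $O$
of edges, a path can be thinned beyond index $d$ so that the spanned edges starting at its cut point
of index $d$ all lie in $O$ or all avoid it. The consequences are `PathSystem.exists_near_of_open`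
for open sets and `PathSystem.IsNull.iUnion` for countable unions of null sets.

The substance is the pigeonhole principle for trees, `SMTree.pigeonhole`. An edge spanned by $U$
from cut index $n$ is a map along the lifts of $U$ to some later cut level $k$, followed by $u_k^+$
(`exists_isLiftMap_of_mem_span`, `IsLiftMap.exists_edge`). So one colours pairs $(k,w)$ with $w$ a
map from the starting level to cut level $k$. Duplication lets every natural number $\ell$ act on
such pairs: pass to the next cut level, taking the successors that were taken at level $\ell$.
Finite words of numbers thereby act on the pairs, and an idempotent ultrafilter on variable words,
obtained from the Hales–Jewett theorem, yields a recurrence statement in the spirit of the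
Carlson–Simpson theorem (`exists_recurrent_coloring`).

Two points connect words to subtrees. First, a thinned path is made rich: its edges already exhibit
every simultaneous choice of successors that can ever be met, so each one-step continuation in a
subtree copies a level from a fixed finite range (`IsRich.exists_copy`). Second, the next edge must
be fixed before the copied level $f$ is known. The variable is therefore replaced by the level at
which the copy of $f$ has just been placed, which has the same effect as substituting $f$
(`copyWord_congr`). -/

/-! ### Idempotent ultrafilters on variable words -/

section VariableWords

open Filter

attribute [local instance] Ultrafilter.semigroup

/-- Substitution of the letter `f` for the variable `none` in a variable word. -/
def substWord (f : ℕ) : FreeMonoid (Option ℕ) →* FreeMonoid ℕ :=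
  FreeMonoid.map (fun o => o.getD f)

/-- This is the Hales–Jewett theorem over the alphabet `S`: a combinatorial line, read along an
enumeration of its coordinates, is a variable word. -/
theorem exists_line_list {κ : Type} [Finite κ] (S : Finset ℕ) (C : FreeMonoid ℕ → κ) :
    ∃ v : FreeMonoid (Option ℕ), none ∈ v.toList ∧
      ∀ f ∈ S, ∀ f' ∈ S, C (substWord f v) = C (substWord f' v) := by
  obtain ⟨ι, hι, h⟩ := Combinatorics.Line.exists_mono_in_high_dimension S κ
  obtain ⟨l, c, hl⟩ := h fun x =>
    C (FreeMonoid.ofList ((Finset.univ : Finset ι).toList.map fun i => (x i : ℕ)))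
  refine ⟨FreeMonoid.ofList ((Finset.univ : Finset ι).toList.map
    fun i => (l.idxFun i).map (fun s : S => (s : ℕ))), ?_, ?_⟩
  · obtain ⟨i, hi⟩ := l.proper
    exact List.mem_map.2 ⟨i, by simp, by simp [hi]⟩
  · have key : ∀ f (hf : f ∈ S), C (substWord f (FreeMonoid.ofList
        ((Finset.univ : Finset ι).toList.map
          fun i => (l.idxFun i).map (fun s : S => (s : ℕ))))) = c := by
      intro f hf
      rw [← hl ⟨f, hf⟩]
      congr 1
      unfold substWord
      rw [← FreeMonoid.ofList_map, List.map_map]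
      congr 1
      apply List.map_congr_left
      intro i _
      simp only [Function.comp, Combinatorics.Line.apply_def]
      cases l.idxFun i <;> rfl
    intro f hf f' hf'
    rw [key f hf, key f' hf']

/-- The ultrafilters concentrated on proper variable words whose image under the substitution of a
letter does not depend on the letter. -/
def lineUltrafilters : Set (Ultrafilter (FreeMonoid (Option ℕ))) :=
  {q | (∀ᶠ v in (q : Filter (FreeMonoid (Option ℕ))), none ∈ FreeMonoid.toList v) ∧
    ∀ (B : Set (FreeMonoid ℕ)) (f f' : ℕ), ∀ᶠ v in (q : Filter (FreeMonoid (Option ℕ))),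
      substWord f v ∈ B ↔ substWord f' v ∈ B}

/-- The defining conditions have the finite intersection property. Finitely many of them involve
finitely many letters and sets; colouring a word by its memberships in these sets, Hales–Jewett
gives one variable word satisfying all of them. -/
theorem lineUltrafilters_nonempty : lineUltrafilters.Nonempty := by
  let gen : Set (Set (FreeMonoid (Option ℕ))) :=
    insert {v | none ∈ FreeMonoid.toList v}
      (Set.range fun x : Set (FreeMonoid ℕ) × ℕ × ℕ =>
        {v | substWord x.2.1 v ∈ x.1 ↔ substWord x.2.2 v ∈ x.1})
  have hne : (Filter.generate gen).NeBot := by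
    rw [Filter.generate_neBot_iff]
    intro t ht hfin
    have hsub : t \ {{v | none ∈ FreeMonoid.toList v}} ⊆
        Set.range fun x : Set (FreeMonoid ℕ) × ℕ × ℕ =>
          {v | substWord x.2.1 v ∈ x.1 ↔ substWord x.2.2 v ∈ x.1} := by
      intro s hs
      rcases ht hs.1 with h | h
      · exact absurd h hs.2
      · exact h
    rw [← Set.image_univ] at hsub
    obtain ⟨I, -, hIfin, hIt⟩ := (Set.exists_subset_image_finite_and
      (p := fun A => A = t \ {{v | none ∈ FreeMonoid.toList v}})).1
        ⟨_, hsub, hfin.subset Set.sdiff_subset, rfl⟩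
    let S : Finset ℕ := hIfin.toFinset.image (fun x => x.2.1) ∪ hIfin.toFinset.image (fun x => x.2.2)
    classical
    have : Finite I := hIfin
    obtain ⟨v, hv, hmono⟩ := exists_line_list S
      (fun w => fun x : hIfin.toFinset => decide (w ∈ x.1.1))
    refine ⟨v, fun s hs => ?_⟩
    by_cases h : s = {v | none ∈ FreeMonoid.toList v}
    · rw [h]; exact hv
    · have : s ∈ t \ {{v | none ∈ FreeMonoid.toList v}} := ⟨hs, h⟩
      rw [← hIt] at this
      obtain ⟨x, hx, rfl⟩ := this
      have h1 := hmono x.2.1 (Finset.mem_union_left _ (Finset.mem_image_of_mem _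
        (hIfin.mem_toFinset.2 hx))) x.2.2 (Finset.mem_union_right _ (Finset.mem_image_of_mem _
        (hIfin.mem_toFinset.2 hx)))
      have h2 := congrFun h1 ⟨x, hIfin.mem_toFinset.2 hx⟩
      simpa using h2
  refine ⟨Ultrafilter.of (Filter.generate gen), ?_, ?_⟩
  · exact Ultrafilter.of_le _ (Filter.GenerateSets.basic (Set.mem_insert _ _))
  · intro B f f'
    exact Ultrafilter.of_le _ (Filter.GenerateSets.basic
      (Set.mem_insert_of_mem _ ⟨(B, f, f'), rfl⟩))

theorem lineUltrafilters_isClosed : IsClosed lineUltrafilters := by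
  have : lineUltrafilters = {q : Ultrafilter _ | {v | none ∈ FreeMonoid.toList v} ∈ q} ∩
      ⋂ (B : Set (FreeMonoid ℕ)) (f : ℕ) (f' : ℕ),
        {q : Ultrafilter _ | {v | substWord f v ∈ B ↔ substWord f' v ∈ B} ∈ q} := by
    ext q
    simp only [Set.mem_inter_iff, Set.mem_iInter]
    rfl
  rw [this]
  exact (ultrafilter_isClosed_basic _).inter (isClosed_iInter fun _ => isClosed_iInter fun _ =>
    isClosed_iInter fun _ => ultrafilter_isClosed_basic _)

/-- The letter is exchanged in one factor at a time: in the left factor by testing `q` on the set of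
words with `q'`-many good continuations, then in the right factor with the left one held fixed. -/
theorem lineUltrafilters_mul {q q' : Ultrafilter (FreeMonoid (Option ℕ))}
    (hq : q ∈ lineUltrafilters) (hq' : q' ∈ lineUltrafilters) : q * q' ∈ lineUltrafilters := by
  refine ⟨?_, fun B f f' => ?_⟩
  · rw [Ultrafilter.eventually_mul]
    filter_upwards [hq.1] with v hv
    exact Eventually.of_forall fun v' => by
      rw [FreeMonoid.toList_mul]; exact List.mem_append_left _ hv
  · rw [Ultrafilter.eventually_mul]
    have key : ∀ᶠ v in q, (∀ᶠ v' in q', substWord f v * substWord f v' ∈ B) ↔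
        (∀ᶠ v' in q', substWord f' v * substWord f v' ∈ B) :=
      hq.2 {s | ∀ᶠ v' in q', s * substWord f v' ∈ B} f f'
    filter_upwards [key] with v hv
    have h2 := hq'.2 {s | substWord f' v * s ∈ B} f f'
    simp only [map_mul]
    by_cases hc : ∀ᶠ v' in q', substWord f v * substWord f v' ∈ B
    · filter_upwards [hc, hv.1 hc, h2] with v' h3 h4 h5
      exact ⟨fun _ => h5.1 h4, fun _ => h3⟩
    · have hc' : ¬ ∀ᶠ v' in (q' : Filter (FreeMonoid (Option ℕ))),
          substWord f' v * substWord f v' ∈ B := fun h => hc (hv.2 h)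
      rw [← Ultrafilter.eventually_not] at hc
      rw [← Ultrafilter.eventually_not] at hc'
      filter_upwards [hc, hc', h2] with v' h3 h4 h5
      exact ⟨fun h => absurd h h3, fun h => absurd (h5.2 h) h4⟩

theorem exists_idempotent_lineUltrafilter : ∃ q ∈ lineUltrafilters, q * q = q :=
  exists_idempotent_in_compact_subsemigroup Ultrafilter.continuous_mul_left lineUltrafilters
    lineUltrafilters_nonempty lineUltrafilters_isClosed.isCompact
    fun _ hq _ hq' => lineUltrafilters_mul hq hq'

/-- The part of a variable word before the first occurrence of the variable. -/
def constPrefix : List (Option ℕ) → List ℕ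
  | [] => []
  | none :: _ => []
  | some a :: v => a :: constPrefix v

theorem exists_eq_constPrefix_append {v : List (Option ℕ)} (hv : none ∈ v) :
    ∃ z, v = (constPrefix v).map some ++ none :: z := by
  induction v with
  | nil => simp at hv
  | cons o v ih =>
    cases o with
    | none => exact ⟨v, rfl⟩
    | some a =>
      obtain ⟨z, hz⟩ := ih (by simpa using hv)
      exact ⟨z, by simpa [constPrefix] using hz⟩

/-- `G` is a set of good states for the colour `E'`. From finitely many good states at once, a
common word `t` reaches the colour, and continuing with any letter `f` and then `z` with `f`
substituted returns to good states, with `z` independent of `f`. The letter `f` stands directly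
after `t` because `t` absorbs the constants preceding the first variable. -/
theorem exists_recurrent_coloring {Z : Type*} (act : Z → ℕ → Z) (E : Set Z) (z₀ : Z) :
    ∃ G E' : Set Z, (E' = E ∨ E' = Eᶜ) ∧ z₀ ∈ G ∧ ∀ W : Set Z, W.Finite → W ⊆ G →
      ∀ S : Finset ℕ, ∃ (t : List ℕ) (z : List (Option ℕ)), t ≠ [] ∧ ∀ w ∈ W,
        t.foldl act w ∈ E' ∧
          ∀ f ∈ S, (t ++ f :: z.map fun o => o.getD f).foldl act w ∈ G := by
  obtain ⟨q, hq, hqq⟩ := exists_idempotent_lineUltrafilter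
  let p : Ultrafilter (FreeMonoid ℕ) := q.map (substWord 0)
  -- By invariance `p` is the image of `q` under every substitution, and `p` inherits idempotence.
  have hp : ∀ (B : Set (FreeMonoid ℕ)) (f : ℕ),
      (∀ᶠ s in (p : Filter (FreeMonoid ℕ)), s ∈ B) ↔
        ∀ᶠ v in (q : Filter (FreeMonoid (Option ℕ))), substWord f v ∈ B := by
    intro B f
    exact Filter.eventually_congr (hq.2 B 0 f)
  have hpp : ∀ B : Set (FreeMonoid ℕ), (∀ᶠ s in (p : Filter (FreeMonoid ℕ)), s ∈ B) ↔
      ∀ᶠ s in (p : Filter (FreeMonoid ℕ)), ∀ᶠ s' in (p : Filter (FreeMonoid ℕ)), s * s' ∈ B := by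
    intro B
    rw [hp B 0, ← hqq, Ultrafilter.eventually_mul]
    simp only [map_mul]
    rfl
  let run : Z → FreeMonoid ℕ → Z := fun w s => (FreeMonoid.toList s).foldl act w
  have hrun : ∀ w s s', run w (s * s') = run (run w s) s' := fun w s s' => by
    simp only [run, FreeMonoid.toList_mul, List.foldl_append]
  let pre : FreeMonoid (Option ℕ) → FreeMonoid ℕ := fun v => FreeMonoid.ofList (constPrefix v.toList)
  -- `F` tests the colour at the moment when the first variable is about to be read. Averaging over
  -- `p` in `H` makes the condition recurrent.
  let F : Set Z → Set Z := fun E => {u | ∀ᶠ v in (q : Filter (FreeMonoid (Option ℕ))), run u (pre v) ∈ E}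
  let H : Set Z → Set Z := fun E => {u | ∀ᶠ s in (p : Filter (FreeMonoid ℕ)), run u s ∈ F E}
  obtain ⟨E', hE', h0⟩ : ∃ E', (E' = E ∨ E' = Eᶜ) ∧ z₀ ∈ H E' := by
    by_cases h : z₀ ∈ H E
    · exact ⟨E, Or.inl rfl, h⟩
    · refine ⟨Eᶜ, Or.inr rfl, ?_⟩
      have h1 := Ultrafilter.eventually_not.2 h
      exact h1.mono fun s hs => Ultrafilter.eventually_not.2 hs
  refine ⟨H E', E', hE', h0, fun W hW hWG S => ?_⟩
  have hne : ∀ᶠ s in (p : Filter (FreeMonoid ℕ)), FreeMonoid.toList s ≠ [] := by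
    refine (hp {s | FreeMonoid.toList s ≠ []} 0).2 (hq.1.mono fun v hv h => ?_)
    have : v.toList = [] := by simpa [substWord] using h
    rw [this] at hv
    simp at hv
  have h1 : ∀ᶠ s in (p : Filter (FreeMonoid ℕ)), ∀ w ∈ W, run w s ∈ F E' :=
    (Filter.eventually_all_finite hW).2 fun w hw => hWG hw
  -- Idempotence is used twice: to see that `p`-most words lead from `H E'` back into `H E'`, and to
  -- split such a word into two factors.
  have h2 : ∀ᶠ s in (p : Filter (FreeMonoid ℕ)), ∀ w ∈ W,
      ∀ᶠ s' in (p : Filter (FreeMonoid ℕ)), run w (s * s') ∈ H E' := by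
    refine (Filter.eventually_all_finite hW).2 fun w hw => (hpp {s | run w s ∈ H E'}).1 ?_
    have := (hpp {s | run w s ∈ F E'}).1 (hWG hw)
    refine this.mono fun s hs => ?_
    refine Filter.Eventually.mono hs fun s' hs' => ?_
    have h5 : run w (s * substWord 0 s') ∈ F E' := hs'
    rw [hrun] at h5
    exact h5
  obtain ⟨s, hs, hs1, hs2⟩ := (hne.and (h1.and h2)).exists
  have h3 : ∀ᶠ v in (q : Filter (FreeMonoid (Option ℕ))), ∀ w ∈ W, run (run w s) (pre v) ∈ E' :=
    (Filter.eventually_all_finite hW).2 hs1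
  have h4 : ∀ᶠ v in (q : Filter (FreeMonoid (Option ℕ))), ∀ w ∈ W, ∀ f ∈ S,
      run w (s * substWord f v) ∈ H E' :=
    (Filter.eventually_all_finite hW).2 fun w hw => (Filter.eventually_all_finset S).2 fun f _ =>
      (hp {s' | run w (s * s') ∈ H E'} f).1 (hs2 w hw)
  obtain ⟨v, hv, hv3, hv4⟩ := (hq.1.and (h3.and h4)).exists
  obtain ⟨z, hz⟩ := exists_eq_constPrefix_append hv
  refine ⟨s.toList ++ constPrefix v.toList, z, by simp [hs], fun w hw => ⟨?_, fun f hf => ?_⟩⟩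
  · have := hv3 w hw
    rw [← hrun] at this
    exact this
  · have h5 := hv4 w hw f hf
    have h6 : (s * substWord f v).toList =
        s.toList ++ constPrefix v.toList ++ f :: z.map fun o => o.getD f := by
      rw [FreeMonoid.toList_mul, List.append_assoc]
      congr 1
      have h7 : (substWord f v).toList = v.toList.map fun o => o.getD f := rfl
      rw [h7]
      conv_lhs => rw [hz]
      simp
    have h8 : run w (s * substWord f v) = (s * substWord f v).toList.foldl act w := rfl
    rw [h8, h6] at h5
    exact h5

end VariableWords

/-! ### Abstract path systems -/

/-- Finite paths from `m` to `n` along edges with the given sources and targets. -/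
def IsPathBetween {E : Type*} (src tgt : E → ℕ) : ℕ → List E → ℕ → Prop
  | m, [], n => m = n
  | m, e :: l, n => src e = m ∧ IsPathBetween src tgt (tgt e) l n

theorem isPathBetween_append {E : Type*} {src tgt : E → ℕ} {l l' : List E} {m n : ℕ} :
    IsPathBetween src tgt m (l ++ l') n ↔
      ∃ k, IsPathBetween src tgt m l k ∧ IsPathBetween src tgt k l' n := by
  induction l generalizing m with
  | nil => simp [IsPathBetween]
  | cons e l ih => simp [IsPathBetween, ih, and_assoc]

/-- An abstract system of edges between natural numbers, in which `sp e l` says that the edge `e` is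
spanned by the path `l`. -/
structure PathSystem (E : Type*) where
  src : E → ℕ
  tgt : E → ℕ
  sp : E → List E → Prop
  src_lt_tgt : ∀ e, src e < tgt e
  isPath_of_sp : ∀ e l, sp e l → IsPathBetween src tgt (src e) l (tgt e)
  sp_self : ∀ e, sp e [e]
  sp_subst : ∀ e d l l₁ l₂, sp e (l₁ ++ d :: l₂) → sp d l → sp e (l₁ ++ l ++ l₂)
  finite_edges : ∀ m n, {e | src e = m ∧ tgt e = n}.Finite

namespace PathSystem

variable {E : Type*} (P : PathSystem E)

/-- Infinite paths starting at `0`. -/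
def IsInf (U : ℕ → E) : Prop := P.src (U 0) = 0 ∧ ∀ i, P.src (U (i + 1)) = P.tgt (U i)

/-- The segment of the path `U` consisting of the edges with indices in `[i, j)`. -/
def seg (U : ℕ → E) (i j : ℕ) : List E := (List.range' i (j - i)).map U

/-- The edges spanned by segments of `U`. -/
def Span (U : ℕ → E) : Set E := {e | ∃ i j, i < j ∧ P.sp e (seg U i j)}

theorem seg_self (U : ℕ → E) (i : ℕ) : seg U i i = [] := by simp [seg]

theorem seg_succ_left (U : ℕ → E) {i j : ℕ} (h : i < j) : seg U i j = U i :: seg U (i + 1) j := by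
  have : j - i = (j - (i + 1)) + 1 := by omega
  rw [seg, this, List.range'_succ]
  rfl

theorem seg_append (U : ℕ → E) {i j k : ℕ} (h : i ≤ j) (h' : j ≤ k) :
    seg U i j ++ seg U j k = seg U i k := by
  obtain ⟨r, rfl⟩ := Nat.exists_eq_add_of_le h
  obtain ⟨s, rfl⟩ := Nat.exists_eq_add_of_le h'
  rw [seg, seg, seg, ← List.map_append]
  congr 1
  rw [Nat.add_sub_cancel_left, Nat.add_sub_cancel_left, Nat.add_assoc, Nat.add_sub_cancel_left]
  simp

theorem seg_succ_right (U : ℕ → E) {i j : ℕ} (h : i ≤ j) : seg U i (j + 1) = seg U i j ++ [U j] := by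
  rw [← seg_append U h (Nat.le_succ j), seg_succ_left U (Nat.lt_succ_self j), seg_self]

theorem seg_congr {U V : ℕ → E} {i j i' j' : ℕ} (hij : j - i = j' - i')
    (h : ∀ s, s < j - i → U (i + s) = V (i' + s)) : seg U i j = seg V i' j' := by
  apply List.ext_getElem
  · simp [seg, hij]
  · intro s hs _
    simp only [seg, List.length_map, List.length_range'] at hs
    simp [seg, h s hs]

variable {P}

theorem head_seg {U : ℕ → E} {i j : ℕ} (h : i < j) : (seg U i j).head? = some (U i) := by
  rw [seg_succ_left U h]; rfl

theorem last_seg {U : ℕ → E} {i j : ℕ} (h : i < j) : (seg U i j).getLast? = some (U (j - 1)) := by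
  obtain ⟨r, rfl⟩ : ∃ r, j = r + 1 := ⟨j - 1, by omega⟩
  rw [seg_succ_right U (by omega)]; simp

theorem head_of_sp {e : E} {l : List E} (h : P.sp e l) : ∃ a ∈ l.head?, P.src a = P.src e := by
  have h' := P.isPath_of_sp e l h
  cases l with
  | nil => exact absurd h' (P.src_lt_tgt e).ne
  | cons a l => exact ⟨a, rfl, h'.1⟩

theorem last_of_sp {e : E} {l : List E} (h : P.sp e l) : ∃ a ∈ l.getLast?, P.tgt a = P.tgt e := by
  have h' := P.isPath_of_sp e l h
  rcases List.eq_nil_or_concat l with rfl | ⟨l, a, rfl⟩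
  · exact absurd h' (P.src_lt_tgt e).ne
  · rw [List.concat_eq_append, isPathBetween_append] at h'
    obtain ⟨k, -, -, h2⟩ := h'
    exact ⟨a, by simp, h2⟩

theorem sp.src_eq {e : E} {U : ℕ → E} {i j : ℕ} (h : P.sp e (seg U i j)) (hij : i < j) :
    P.src (U i) = P.src e := by
  obtain ⟨a, ha, h'⟩ := head_of_sp h
  rw [head_seg hij] at ha
  cases ha; exact h'

namespace IsInf

variable {U V W : ℕ → E}

theorem strictMono (hU : P.IsInf U) : StrictMono fun i => P.src (U i) :=
  strictMono_nat_of_lt_succ fun i => by rw [hU.2 i]; exact P.src_lt_tgt _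

theorem sp_tgt_eq (hU : P.IsInf U) {e : E} {i j : ℕ} (h : P.sp e (seg U i j)) (hij : i < j) :
    P.tgt e = P.src (U j) := by
  obtain ⟨a, ha, h'⟩ := last_of_sp h
  rw [last_seg hij] at ha
  cases ha
  obtain ⟨r, rfl⟩ : ∃ r, j = r + 1 := ⟨j - 1, by omega⟩
  rw [hU.2, ← h']; rfl

theorem mem_span (i : ℕ) : U i ∈ P.Span U :=
  ⟨i, i + 1, Nat.lt_succ_self i, by
    rw [seg_succ_left U (Nat.lt_succ_self i), seg_self]; exact P.sp_self _⟩

/-- The edges of `V` are replaced from left to right by the segments of `U` that span them. These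
segments fit together because sources determine indices in `U`. -/
theorem exists_substitution (hU : P.IsInf U) (hV : P.IsInf V) (h : ∀ i, V i ∈ P.Span U)
    {e : E} {i j : ℕ} {a : ℕ} (ha : P.src (U a) = P.src (V i))
    (he : P.sp e (seg V i j)) (r : ℕ) (hr : i + r ≤ j) :
    ∃ b, a ≤ b ∧ P.src (U b) = P.src (V (i + r)) ∧ P.sp e (seg U a b ++ seg V (i + r) j) := by
  induction r with
  | zero => exact ⟨a, le_rfl, ha, by rw [seg_self]; exact he⟩
  | succ r ih =>
    obtain ⟨b, hab, hb, hsp⟩ := ih (by omega)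
    obtain ⟨a', b', hab', h'⟩ := h (i + r)
    have h1 : a' = b := hU.strictMono.injective
      (show P.src (U a') = P.src (U b) by rw [hb, h'.src_eq hab'])
    subst h1
    refine ⟨b', by omega, ?_, ?_⟩
    · rw [← add_assoc, hV.2, hU.sp_tgt_eq h' hab']
    · rw [seg_succ_left V (by omega)] at hsp
      have := P.sp_subst _ _ _ _ _ hsp h'
      rwa [seg_append U hab hab'.le] at this

theorem span_subset (hU : P.IsInf U) (hV : P.IsInf V) (h : ∀ i, V i ∈ P.Span U) :
    P.Span V ⊆ P.Span U := by
  rintro e ⟨i, j, hij, he⟩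
  obtain ⟨a, b, hab, h'⟩ := h i
  obtain ⟨b, hab, hb, hsp⟩ := hU.exists_substitution hV h (h'.src_eq hab) he (j - i)
    (by omega)
  rw [Nat.add_sub_cancel' hij.le] at hb hsp
  rw [seg_self, List.append_nil] at hsp
  refine ⟨a, b, ?_, hsp⟩
  by_contra hc
  have h1 : a = b := by omega
  subst h1
  rw [seg_self] at hsp
  obtain ⟨_, h2, _⟩ := head_of_sp hsp
  simp at h2

end IsInf

variable (P) in
/-- `V` is an infinite path spanned by `U` that agrees with `U` below the index `d`. -/
def Near (d : ℕ) (U V : ℕ → E) : Prop := P.IsInf V ∧ (∀ i, V i ∈ P.Span U) ∧ ∀ i < d, V i = U i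

theorem Near.refl {U : ℕ → E} (hU : P.IsInf U) (d : ℕ) : P.Near d U U :=
  ⟨hU, fun i => IsInf.mem_span i, fun _ _ => rfl⟩

theorem Near.trans {U V W : ℕ → E} {d d' : ℕ} (hU : P.IsInf U) (h : P.Near d U V)
    (h' : P.Near d' V W) (hd : d ≤ d') : P.Near d U W :=
  ⟨h'.1, fun i => hU.span_subset h.1 h.2.1 (h'.2.1 i),
    fun i hi => by rw [h'.2.2 i (by omega), h.2.2 i hi]⟩

theorem Near.src_eq {U V : ℕ → E} {d i : ℕ} (hU : P.IsInf U) (h : P.Near d U V) (hi : i ≤ d) :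
    P.src (V i) = P.src (U i) := by
  cases i with
  | zero => rw [h.1.1, hU.1]
  | succ i => rw [h.1.2, hU.2, h.2.2 i (by omega)]

variable (P) in
/-- Finite paths from `m` to `n`. -/
abbrev IsPath (m : ℕ) (l : List E) (n : ℕ) : Prop := IsPathBetween P.src P.tgt m l n

theorem isPath_le {l : List E} {m n : ℕ} (h : P.IsPath m l n) : m ≤ n := by
  induction l generalizing m with
  | nil => exact Nat.le_of_eq h
  | cons e l ih => have := ih h.2; have := P.src_lt_tgt e; have := h.1; omega

theorem IsInf.isPath_seg {U : ℕ → E} (hU : P.IsInf U) {i j : ℕ} (h : i ≤ j) :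
    P.IsPath (P.src (U i)) (seg U i j) (P.src (U j)) := by
  induction j, h using Nat.le_induction with
  | base => rw [seg_self]; rfl
  | succ j hj ih => rw [seg_succ_right U hj]; refine isPathBetween_append.2 ?_; exact ⟨_, ih, rfl, (hU.2 j).symm⟩

theorem isPath_unique {l : List E} {m n n' : ℕ} (h : P.IsPath m l n) (h' : P.IsPath m l n') :
    n = n' := by
  induction l generalizing m with
  | nil => exact h.symm.trans h'
  | cons e l ih => exact ih h.2 h'.2

theorem finite_isPath (m n : ℕ) : {l | P.IsPath m l n}.Finite := by
  induction hk : n - m using Nat.strong_induction_on generalizing m with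
  | _ k ih =>
    have h1 : {l | P.IsPath m l n} ⊆ {[]} ∪ ⋃ c ∈ Set.Ioc m n,
        (fun x : E × List E => x.1 :: x.2) ''
          ({e | P.src e = m ∧ P.tgt e = c} ×ˢ {l | P.IsPath c l n}) := by
      intro l hl
      cases l with
      | nil => exact Or.inl rfl
      | cons e l =>
        right
        have := P.src_lt_tgt e
        have h2 := hl.1
        have h3 := isPath_le hl.2
        simp only [Set.mem_iUnion]
        exact ⟨P.tgt e, ⟨by omega, h3⟩, (e, l), ⟨⟨hl.1, rfl⟩, hl.2⟩, rfl⟩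
    refine Set.Finite.subset (Set.Finite.union (Set.finite_singleton _)
      (Set.Finite.biUnion (Set.finite_Ioc m n) fun c hc => ?_)) h1
    exact (((P.finite_edges m c).prod (ih (n - c) (by have := hc.1; have := hc.2; omega) c rfl)).image _)

/-- The path that follows `U` up to index `d` and then follows `A` from index `k` on. -/
def splice (d : ℕ) (U : ℕ → E) (k : ℕ) (A : ℕ → E) : ℕ → E :=
  fun i => if i < d then U i else A (i - d + k)

section splice

variable {U A : ℕ → E} {d k : ℕ}

theorem splice_isInf (hU : P.IsInf U) (hA : P.IsInf A) (h : P.src (U d) = P.src (A k)) :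
    P.IsInf (splice d U k A) := by
  constructor
  · unfold splice
    split_ifs with h0
    · exact hU.1
    · obtain rfl : d = 0 := by omega
      rw [Nat.sub_zero, Nat.zero_add, ← h, hU.1]
  · intro i
    unfold splice
    by_cases h1 : i + 1 < d
    · rw [if_pos h1, if_pos (by omega), hU.2]
    · by_cases h2 : i < d
      · obtain rfl : d = i + 1 := by omega
        rw [if_neg h1, if_pos h2, Nat.sub_self, Nat.zero_add, ← h, hU.2]
      · rw [if_neg h1, if_neg h2, ← hA.2]
        congr 2
        omega

theorem splice_near (hU : P.IsInf U) (hA : P.IsInf A) (h : P.src (U d) = P.src (A k))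
    (hs : ∀ i, k ≤ i → A i ∈ P.Span U) : P.Near d U (splice d U k A) := by
  refine ⟨splice_isInf hU hA h, fun i => ?_, fun i hi => if_pos hi⟩
  unfold splice
  split_ifs
  · exact IsInf.mem_span i
  · exact hs _ (by omega)

theorem mem_span_of_near {V : ℕ → E} (hU : P.IsInf U) (hV : ∀ i < d, V i = U i) {e : E}
    (he : e ∈ P.Span U) (ht : P.tgt e ≤ P.src (U d)) : e ∈ P.Span V := by
  obtain ⟨i, j, hij, h⟩ := he
  rw [hU.sp_tgt_eq h hij] at ht
  have hj : j ≤ d := hU.strictMono.le_iff_le.1 ht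
  refine ⟨i, j, hij, ?_⟩
  rwa [seg_congr (V := U) rfl fun s hs => hV _ (by omega)]

/-- A segment starting at or after the splice point is a shifted segment of `A`. -/
theorem mem_span_of_splice (hU : P.IsInf U) (hA : P.IsInf A) (h : P.src (U d) = P.src (A k))
    {e : E} (he : e ∈ P.Span (splice d U k A)) (hs : P.src (U d) ≤ P.src e) : e ∈ P.Span A := by
  obtain ⟨i, j, hij, h'⟩ := he
  have hS := splice_isInf hU hA h
  have hd : P.src (splice d U k A d) = P.src (U d) := by simp [splice, h]
  rw [← hd, ← h'.src_eq hij] at hs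
  have hi : d ≤ i := hS.strictMono.le_iff_le.1 hs
  refine ⟨i - d + k, j - d + k, by omega, ?_⟩
  rwa [seg_congr (V := splice d U k A) (i' := i) (j' := j) (by omega) fun s _ => ?_]
  simp only [splice]
  rw [if_neg (by omega)]
  congr 1
  omega

end splice

theorem near_of_splice_tail {U V : ℕ → E} {d : ℕ} (hU : P.IsInf U) (hV : P.Near d U V) : 
    ∀ y : List E, P.IsPath 0 y (P.src (U d)) → (∀ e ∈ y, e ∈ P.Span U) → ∀ e ∈ y, e ∈ P.Span V := by
  intro y hy hs e he
  refine mem_span_of_near hU hV.2.2 (hs e he) ?_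
  obtain ⟨l, l', rfl⟩ := List.append_of_mem he
  obtain ⟨_, _, _, h⟩ := isPathBetween_append.1 hy
  exact isPath_le h

/-! ### Fusion -/

section fusion

variable (Good : List E → (ℕ → E) → Prop)
  (hered : ∀ y U V, P.IsInf U → P.IsInf V → (∀ i, V i ∈ P.Span U) → (∀ e ∈ y, e ∈ P.Span V) →
    Good y U → Good y V)
  (dense : ∀ U d y, P.IsInf U → P.IsPath 0 y (P.src (U d)) → (∀ e ∈ y, e ∈ P.Span U) →
    ∃ V, P.Near d U V ∧ Good y V)

include hered dense

theorem exists_near_good_finite {U : ℕ → E} (hU : P.IsInf U) (d : ℕ) {S : Set (List E)}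
    (hS : S.Finite) (hp : ∀ y ∈ S, P.IsPath 0 y (P.src (U d))) :
    ∃ V, P.Near d U V ∧ ∀ y ∈ S, (∀ e ∈ y, e ∈ P.Span V) → Good y V := by
  induction S, hS using Set.Finite.induction_on with
  | empty => exact ⟨U, Near.refl hU d, by simp⟩
  | @insert y S _ _ ih =>
    obtain ⟨V, hV, hg⟩ := ih fun y hy => hp y (Set.mem_insert_of_mem _ hy)
    by_cases hy : ∀ e ∈ y, e ∈ P.Span V
    · obtain ⟨W, hW, hgW⟩ := dense V d y hV.1
        (by rw [hV.src_eq hU le_rfl]; exact hp y (Set.mem_insert _ _)) hy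
      refine ⟨W, hV.trans hU hW le_rfl, ?_⟩
      rintro y' (rfl | hy') hs
      · exact hgW
      · exact hered _ _ _ hV.1 hW.1 hW.2.1 hs (hg y' hy' fun e he =>
          hV.1.span_subset hW.1 hW.2.1 (hs e he))
    · refine ⟨V, hV, ?_⟩
      rintro y' (rfl | hy') hs
      · exact absurd hs hy
      · exact hg y' hy' hs

/-- Only finitely many finite paths end at a given cut point, so all of them can be treated at stage
`r` without changing the first `d + r` edges. The limit path inherits goodness by heredity. -/
theorem exists_near_good {U : ℕ → E} (hU : P.IsInf U) (d : ℕ) :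
    ∃ V, P.Near d U V ∧ ∀ d' ≥ d, ∀ y, P.IsPath 0 y (P.src (V d')) → (∀ e ∈ y, e ∈ P.Span V) →
      Good y V := by
  have step : ∀ (r : ℕ) (U : {U // P.IsInf U}), ∃ V : {V // P.IsInf V}, P.Near (d + r) U.1 V.1 ∧
      ∀ y, P.IsPath 0 y (P.src (U.1 (d + r))) → (∀ e ∈ y, e ∈ P.Span V.1) → Good y V.1 := by
    rintro r ⟨U, hU⟩
    obtain ⟨V, hV, h⟩ := exists_near_good_finite Good hered dense hU (d + r)
      (finite_isPath (P := P) 0 (P.src (U (d + r)))) fun y hy => hy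
    exact ⟨⟨V, hV.1⟩, hV, h⟩
  choose f hf hfg using step
  let V : ℕ → {V // P.IsInf V} := fun r => Nat.rec ⟨U, hU⟩ (fun r W => f r W) r
  have hV : ∀ r s, r ≤ s → P.Near (d + r) (V r).1 (V s).1 := by
    intro r s hrs
    induction s, hrs using Nat.le_induction with
    | base => exact Near.refl (V r).2 _
    | succ s hs ih => exact ih.trans (V r).2 (hf s (V s)) (by omega)
  -- Edge `i` is final from stage `i + 1` on, whatever `d` is.
  let W : ℕ → E := fun i => (V (i + 1)).1 i
  have hW : ∀ r i, i < d + r → W i = (V r).1 i := by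
    intro r i hi
    rcases le_total r (i + 1) with h | h
    · exact (hV r (i + 1) h).2.2 i hi
    · exact ((hV (i + 1) r h).2.2 i (by omega)).symm
  have hWinf : P.IsInf W := by
    constructor
    · exact (V 1).2.1
    · intro i
      rw [hW (i + 2) (i + 1) (by omega), hW (i + 2) i (by omega)]
      exact (V (i + 2)).2.2 i
  have hWn : ∀ r, P.Near (d + r) (V r).1 W := by
    intro r
    refine ⟨hWinf, fun i => ?_, fun i hi => hW r i hi⟩
    rw [hW (max r (i + 1)) i (by omega)]
    exact (hV r _ (le_max_left _ _)).2.1 i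
  refine ⟨W, hWn 0, fun d' hd' y hy hs => ?_⟩
  obtain ⟨r, rfl⟩ := Nat.exists_eq_add_of_le hd'
  rw [(hWn r).src_eq (V r).2 le_rfl] at hy
  refine hered y (V (r + 1)).1 W (V (r + 1)).2 hWinf (hWn (r + 1)).2.1 hs ?_
  exact hfg r (V r) y hy fun e he =>
    (V (r + 1)).2.span_subset hWinf (hWn (r + 1)).2.1 (hs e he)

end fusion

variable (P) in
/-- The infinite paths spanned by `U` with initial segment `y`. -/
def cyl (y : List E) (U : ℕ → E) : Set (ℕ → E) :=
  {A | P.IsInf A ∧ (∀ i, A i ∈ P.Span U) ∧ seg A 0 y.length = y}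

theorem cyl_mono {y : List E} {U V : ℕ → E} (hU : P.IsInf U) (hV : P.IsInf V)
    (h : ∀ i, V i ∈ P.Span U) : P.cyl y V ⊆ P.cyl y U :=
  fun _ hA => ⟨hA.1, fun i => hU.span_subset hV h (hA.2.1 i), hA.2.2⟩

theorem mem_seg {A : ℕ → E} {i j : ℕ} {e : E} (h : e ∈ seg A i j) : ∃ s, i ≤ s ∧ s < j ∧ A s = e := by
  simp only [seg, List.mem_map, List.mem_range'_1] at h
  obtain ⟨s, hs, rfl⟩ := h
  exact ⟨s, hs.1, by omega, rfl⟩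

theorem seg_length (A : ℕ → E) (i j : ℕ) : (seg A i j).length = j - i := by simp [seg]

theorem cyl_nonempty {y : List E} {U : ℕ → E} {d : ℕ} (hU : P.IsInf U)
    (hy : P.IsPath 0 y (P.src (U d))) (hs : ∀ e ∈ y, e ∈ P.Span U) : (P.cyl y U).Nonempty := by
  let A : ℕ → E := fun i => if h : i < y.length then y[i] else U (i - y.length + d)
  have hA : seg A 0 y.length = y := by
    apply List.ext_getElem
    · simp [seg]
    · intro i _ hi
      simp [seg, A, hi]
  have key : ∀ (l : List E) (m : ℕ) (r : ℕ), P.IsPath m l (P.src (U d)) →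
      (∀ i (h : i < l.length), A (r + i) = l[i]) → r + l.length = y.length →
      P.src (A r) = m ∧ ∀ i ≥ r, P.src (A (i + 1)) = P.tgt (A i) := by
    intro l
    induction l with
    | nil =>
      intro m r hl h hr
      simp only [List.length_nil, add_zero] at hr
      have hA' : ∀ i ≥ r, A i = U (i - r + d) := by
        intro i hi
        simp only [A]
        rw [dif_neg (by omega), hr]
      refine ⟨?_, fun i hi => ?_⟩
      · rw [hA' r le_rfl, Nat.sub_self, Nat.zero_add]
        exact hl.symm
      · rw [hA' i hi, hA' (i + 1) (by omega), ← hU.2]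
        congr 2
        omega
    | cons e l ih =>
      intro m r hl h hr
      have h0 : A r = e := h 0 (by simp)
      obtain ⟨h1, h2⟩ := ih (P.tgt e) (r + 1) hl.2 (fun i hi => by
        have := h (i + 1) (by simpa using hi)
        rw [add_assoc, add_comm 1 i, this]; rfl) (by simp at hr; omega)
      refine ⟨by rw [h0]; exact hl.1, fun i hi => ?_⟩
      rcases Nat.eq_or_lt_of_le hi with rfl | h'
      · rw [h1, h0]
      · exact h2 i h'
  obtain ⟨h1, h2⟩ := key y 0 0 hy (fun i hi => by simp [A, hi]) (by simp)
  refine ⟨A, ⟨h1, fun i => h2 i (Nat.zero_le i)⟩, fun i => ?_, hA⟩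
  simp only [A]
  split_ifs with h
  · exact hs _ (List.getElem_mem h)
  · exact IsInf.mem_span _

/-! ### Combinatorial forcing from the pigeonhole principle -/

section ramsey

variable (P) in
/-- The pigeonhole principle for one-step extensions. -/
def Pigeonhole : Prop :=
  ∀ U, P.IsInf U → ∀ (d : ℕ) (O : Set E), ∃ V, P.Near d U V ∧
    ((∀ e ∈ P.Span V, P.src e = P.src (U d) → e ∈ O) ∨
      ∀ e ∈ P.Span V, P.src e = P.src (U d) → e ∉ O)

variable (P) in
/-- No infinite path spanned by `V` that spans `y` has its cylinder over `y` inside `X`. -/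
def Rejects (X : Set (ℕ → E)) (y : List E) (V : ℕ → E) : Prop :=
  ∀ W, P.IsInf W → (∀ i, W i ∈ P.Span V) → (∀ e ∈ y, e ∈ P.Span W) → ¬ P.cyl y W ⊆ X

theorem Rejects.mono {X : Set (ℕ → E)} {y : List E} {U V : ℕ → E} (h : P.Rejects X y U)
    (hU : P.IsInf U) (hV : P.IsInf V) (hs : ∀ i, V i ∈ P.Span U) : P.Rejects X y V :=
  fun W hW h' => h W hW fun i => hU.span_subset hV hs (h' i)

theorem exists_index {V : ℕ → E} (hV : P.IsInf V) {y : List E} {c : ℕ} (hy : P.IsPath 0 y c)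
    (hs : ∀ e ∈ y, e ∈ P.Span V) : ∃ k, P.src (V k) = c := by
  rcases List.eq_nil_or_concat y with rfl | ⟨l, e, rfl⟩
  · exact ⟨0, by rw [hV.1]; exact hy⟩
  · simp only [List.concat_eq_append] at hy hs
    obtain ⟨k, _, h1, h2⟩ := isPathBetween_append.1 hy
    obtain ⟨i, j, hij, h⟩ := hs e (by simp)
    exact ⟨j, by rw [← hV.sp_tgt_eq h hij]; exact h2⟩

/-- If rejection fails, some `W` accepts `y`. Following `U` up to `d` and `W` afterwards gives a
path near `U` that still accepts, since members of the cylinder use edges beyond `y` only from the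
tail of `W`. -/
theorem accepts_or_rejects (X : Set (ℕ → E)) {U : ℕ → E} (hU : P.IsInf U) {d : ℕ} {y : List E}
    (hy : P.IsPath 0 y (P.src (U d))) :
    ∃ V, P.Near d U V ∧ (P.cyl y V ⊆ X ∨ P.Rejects X y V) := by
  by_cases h : P.Rejects X y U
  · exact ⟨U, Near.refl hU d, Or.inr h⟩
  · simp only [Rejects, not_forall, not_not] at h
    obtain ⟨W, hW, hWU, hyW, hX⟩ := h
    obtain ⟨k, hk⟩ := exists_index hW hy hyW
    have hN := splice_near (d := d) hU hW hk.symm fun i _ => hWU i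
    refine ⟨_, hN, Or.inl fun A hA => hX ⟨hA.1, fun i => ?_, hA.2.2⟩⟩
    by_cases hi : i < y.length
    · apply hyW
      rw [← hA.2.2]
      exact List.mem_map.2 ⟨i, by simp [hi], rfl⟩
    · refine mem_span_of_splice hU hW hk.symm (hA.2.1 i) ?_
      have h1 := hA.1.isPath_seg (Nat.zero_le y.length)
      rw [hA.2.2, hA.1.1] at h1
      rw [(isPath_unique h1 hy).symm]
      exact hA.1.strictMono.monotone (by omega)

theorem isPath_snoc {y : List E} {m : ℕ} {e : E} (hy : P.IsPath m y (P.src e)) :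
    P.IsPath m (y ++ [e]) (P.tgt e) := isPathBetween_append.2 ⟨_, hy, rfl, rfl⟩

theorem IsInf.cyl_seg {y : List E} {U A : ℕ → E} {m : ℕ} (hA : A ∈ P.cyl y U) (hy : P.IsPath 0 y m) :
    P.src (A y.length) = m := by
  have h1 := hA.1.isPath_seg (Nat.zero_le y.length)
  rw [hA.2.2, hA.1.1] at h1
  exact isPath_unique h1 hy

/-- After fusion every path is decided. The pigeonhole principle is applied to the edges whose
addition to `y` is accepted: if all are, then `y` is accepted itself; if none is, all extensions are
rejected. -/
theorem exists_near_accepts_or_rejects_succ (hP : P.Pigeonhole) (X : Set (ℕ → E)) {U : ℕ → E}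
    (hU : P.IsInf U) {d : ℕ} {y : List E} (hy : P.IsPath 0 y (P.src (U d)))
    (hs : ∀ e ∈ y, e ∈ P.Span U) :
    ∃ V, P.Near d U V ∧ (P.cyl y V ⊆ X ∨ P.Rejects X y V ∧
      ∀ e ∈ P.Span V, P.src e = P.src (U d) → P.Rejects X (y ++ [e]) V) := by
  obtain ⟨V, hV, hdec⟩ := exists_near_good (P := P) (fun y V => P.cyl y V ⊆ X ∨ P.Rejects X y V)
    (fun y U V hU hV hs _ h => h.imp (fun h => (cyl_mono hU hV hs).trans h)
      fun h => h.mono hU hV hs)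
    (fun _ _ _ hU hy _ => accepts_or_rejects X hU hy) hU d
  have hyV := near_of_splice_tail hU hV y hy hs
  have hsrc := hV.src_eq hU le_rfl
  rcases hdec d le_rfl y (by rw [hsrc]; exact hy) hyV with h | h
  · exact ⟨V, hV, Or.inl h⟩
  · obtain ⟨W, hW, hO⟩ := hP V hV.1 d {e | P.cyl (y ++ [e]) V ⊆ X}
    rw [hsrc] at hO
    refine ⟨W, hV.trans hU hW le_rfl, ?_⟩
    have hyW := near_of_splice_tail hV.1 hW y (by rw [hsrc]; exact hy) hyV
    rcases hO with hO | hO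
    · refine absurd (fun A hA => ?_) (h W hW.1 hW.2.1 hyW)
      have h1 := hO (A y.length) (hA.2.1 _) (IsInf.cyl_seg hA hy)
      refine h1 ⟨hA.1, fun i => hV.1.span_subset hW.1 hW.2.1 (hA.2.1 i), ?_⟩
      rw [List.length_append, List.length_singleton, seg_succ_right _ (Nat.zero_le _), hA.2.2]
    · right
      refine ⟨h.mono hV.1 hW.1 hW.2.1, fun e he hse => ?_⟩
      have heV := hV.1.span_subset hW.1 hW.2.1 he
      have hye : P.IsPath 0 (y ++ [e]) (P.tgt e) := isPath_snoc (by rw [hse]; exact hy)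
      have hyeV : ∀ e' ∈ y ++ [e], e' ∈ P.Span V := by
        intro e' he'
        rcases List.mem_append.1 he' with h' | h'
        · exact hyV e' h'
        · rw [List.mem_singleton.1 h']; exact heV
      obtain ⟨k, hk⟩ := exists_index hV.1 hye hyeV
      have hkd : d ≤ k := by
        apply hV.1.strictMono.le_iff_le.1
        rw [hk, hsrc, ← hse]
        exact (P.src_lt_tgt e).le
      rcases hdec k hkd (y ++ [e]) (by rw [hk]; exact hye) hyeV with h' | h'
      · exact absurd h' (hO e he hse)
      · exact h'.mono hV.1 hW.1 hW.2.1

/-- By fusion, rejection propagates from a path to its one-step extensions. If `y` is rejected, so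
are all initial segments of `A` beyond `y`, for every `A` in the cylinder; were `A` in `X`, openness
would make a long one accepted. -/
theorem exists_near_of_open (hP : P.Pigeonhole) {X : Set (ℕ → E)}
    (hX : ∀ A ∈ X, P.IsInf A → ∃ m, ∀ m' ≥ m, P.cyl (seg A 0 m') A ⊆ X) {U : ℕ → E}
    (hU : P.IsInf U) {d : ℕ} {y : List E} (hy : P.IsPath 0 y (P.src (U d)))
    (hs : ∀ e ∈ y, e ∈ P.Span U) :
    ∃ V, P.Near d U V ∧ (P.cyl y V ⊆ X ∨ P.cyl y V ∩ X = ∅) := by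
  obtain ⟨V, hV, hdec⟩ := exists_near_good (P := P) (fun y V => P.cyl y V ⊆ X ∨ P.Rejects X y V ∧
      ∀ c, P.IsPath 0 y c → ∀ e ∈ P.Span V, P.src e = c → P.Rejects X (y ++ [e]) V)
    (fun y U V hU hV hs _ h => h.imp (fun h => (cyl_mono hU hV hs).trans h)
      fun h => ⟨h.1.mono hU hV hs, fun c hc e he hec =>
        (h.2 c hc e (hU.span_subset hV hs he) hec).mono hU hV hs⟩)
    (fun U d y hU hy hs => by
      obtain ⟨V, hV, h⟩ := exists_near_accepts_or_rejects_succ hP X hU hy hs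
      refine ⟨V, hV, h.imp_right fun h => ⟨h.1, fun c hc e he hec => h.2 e he ?_⟩⟩
      rw [hec, isPath_unique hc hy]) hU d
  have hyV := near_of_splice_tail hU hV y hy hs
  have hsrc := hV.src_eq hU le_rfl
  refine ⟨V, hV, ?_⟩
  rcases hdec d le_rfl y (by rw [hsrc]; exact hy) hyV with h | h
  · exact Or.inl h
  right
  rw [Set.eq_empty_iff_forall_notMem]
  rintro A ⟨hA, hAX⟩
  have hrej : ∀ r, P.Rejects X (seg A 0 (y.length + r)) V := by
    intro r
    induction r with
    | zero => rw [Nat.add_zero, hA.2.2]; exact h.1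
    | succ r ih =>
      rw [← add_assoc, seg_succ_right _ (Nat.zero_le _)]
      have hp := hA.1.isPath_seg (Nat.zero_le (y.length + r))
      rw [hA.1.1] at hp
      have hsp : ∀ e ∈ seg A 0 (y.length + r), e ∈ P.Span V := by
        intro e he
        obtain ⟨s, _, _, rfl⟩ := mem_seg he
        exact hA.2.1 s
      obtain ⟨k, hk⟩ := exists_index hV.1 hp hsp
      have hkd : d ≤ k := by
        apply hV.1.strictMono.le_iff_le.1
        rw [hk, hsrc, ← IsInf.cyl_seg hA hy]
        exact hA.1.strictMono.monotone (by omega)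
      rcases hdec k hkd _ (by rw [hk]; exact hp) hsp with h' | h'
      · exact absurd h' (ih V hV.1 (fun i => IsInf.mem_span i) hsp)
      · exact h'.2 _ hp _ (hA.2.1 _) rfl
  obtain ⟨m, hm⟩ := hX A hAX hA.1
  -- The basic neighbourhoods of `A` are cylinders in `A` itself. Rejection refers to all paths
  -- spanned by `V`, hence also to `A`.
  refine hrej m A hA.1 hA.2.1 (fun e he => ?_) (hm _ (by omega))
  obtain ⟨s, _, _, rfl⟩ := mem_seg he
  exact IsInf.mem_span s

variable (P) in
/-- Every cylinder can be shrunk so that it avoids `X`. -/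
def IsNull (X : Set (ℕ → E)) : Prop :=
  ∀ U, P.IsInf U → ∀ (d : ℕ) (y : List E), P.IsPath 0 y (P.src (U d)) →
    (∀ e ∈ y, e ∈ P.Span U) → ∃ V, P.Near d U V ∧ P.cyl y V ∩ X = ∅

/-- Fusion makes the cylinder over each `y` avoid the first `y.length` sets. A path in `X j` is then
excluded by its own initial segments of length greater than `j`. -/
theorem IsNull.iUnion {X : ℕ → Set (ℕ → E)} (hX : ∀ n, P.IsNull (X n)) : P.IsNull (⋃ n, X n) := by
  have hfin : ∀ n, P.IsNull (⋃ j < n, X j) := by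
    intro n
    induction n with
    | zero => intro U hU d y _ _; exact ⟨U, Near.refl hU d, by simp⟩
    | succ n ih =>
      intro U hU d y hy hs
      obtain ⟨V, hV, h⟩ := ih U hU d y hy hs
      obtain ⟨W, hW, h'⟩ := hX n V hV.1 d y (by rw [hV.src_eq hU le_rfl]; exact hy)
        (near_of_splice_tail hU hV y hy hs)
      refine ⟨W, hV.trans hU hW le_rfl, ?_⟩
      rw [Set.eq_empty_iff_forall_notMem] at h h' ⊢
      rintro A ⟨hA, hAX⟩
      simp only [Set.mem_iUnion] at hAX
      obtain ⟨j, hj, hAj⟩ := hAX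
      rcases Nat.lt_succ_iff_lt_or_eq.1 hj with hj | rfl
      · exact h A ⟨cyl_mono hV.1 hW.1 hW.2.1 hA, by simp only [Set.mem_iUnion]; exact ⟨j, hj, hAj⟩⟩
      · exact h' A ⟨hA, hAj⟩
  intro U hU d y hy hs
  obtain ⟨V, hV, hdec⟩ := exists_near_good (P := P)
    (fun y V => P.cyl y V ∩ (⋃ j < y.length, X j) = ∅)
    (fun y U V hU hV hs _ h => by
      rw [Set.eq_empty_iff_forall_notMem] at h ⊢
      exact fun A hA => h A ⟨cyl_mono hU hV hs hA.1, hA.2⟩)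
    (fun U d y hU hy hs => hfin _ U hU d y hy hs) hU d
  refine ⟨V, hV, ?_⟩
  rw [Set.eq_empty_iff_forall_notMem]
  rintro A ⟨hA, hAX⟩
  obtain ⟨j, hj⟩ := Set.mem_iUnion.1 hAX
  -- The segment must be longer than `j` and must not end before `y` does.
  let r := y.length + j + 1
  have hp := hA.1.isPath_seg (Nat.zero_le r)
  rw [hA.1.1] at hp
  have hsp : ∀ e ∈ seg A 0 r, e ∈ P.Span V := by
    intro e he
    obtain ⟨s, _, _, rfl⟩ := mem_seg he
    exact hA.2.1 s
  obtain ⟨k, hk⟩ := exists_index hV.1 hp hsp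
  have hkd : d ≤ k := by
    apply hV.1.strictMono.le_iff_le.1
    rw [hk, hV.src_eq hU le_rfl, ← IsInf.cyl_seg hA hy]
    exact hA.1.strictMono.monotone (by omega)
  have h1 := hdec k hkd _ (by rw [hk]; exact hp) hsp
  rw [Set.eq_empty_iff_forall_notMem] at h1
  refine h1 A ⟨⟨hA.1, hA.2.1, by rw [seg_length, Nat.sub_zero]⟩, ?_⟩
  simp only [Set.mem_iUnion]
  exact ⟨j, by rw [seg_length]; omega, hj⟩

end ramsey

end PathSystem

/-! ### Levels, shape-preserving functions and canonical extensions -/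

section Levels

variable {T A : Type*} [PartialOrder T]

namespace STree

variable (τ : STree T A)

include τ

theorem le_or_le_of_le {a b c : T} (ha : a ≤ c) (hb : b ≤ c) : a ≤ b ∨ b ≤ a := by
  rcases eq_or_lt_of_le ha with rfl | ha
  · exact Or.inr hb
  rcases eq_or_lt_of_le hb with rfl | hb
  · exact Or.inl ha.le
  · exact (τ.chain_below c).total ha hb

theorem nodeLevel_lt {a b : T} (h : a < b) : nodeLevel a < nodeLevel b :=
  Set.ncard_lt_ncard ⟨fun _ hx => lt_trans hx h, fun hs => lt_irrefl a (hs h)⟩ (τ.finite_below b)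

theorem nodeLevel_le {a b : T} (h : a ≤ b) : nodeLevel a ≤ nodeLevel b := by
  rcases eq_or_lt_of_le h with rfl | h
  · exact le_rfl
  · exact (τ.nodeLevel_lt h).le

theorem eq_of_le_of_le {a b c : T} (ha : a ≤ c) (hb : b ≤ c) (h : nodeLevel a = nodeLevel b) :
    a = b := by
  rcases τ.le_or_le_of_le ha hb with h' | h' <;> rcases eq_or_lt_of_le h' with h'' | h''
  · exact h''
  · exact absurd h (τ.nodeLevel_lt h'').ne
  · exact h''.symm
  · exact absurd h.symm (τ.nodeLevel_lt h'').ne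

theorem le_of_nodeLevel_le {a b c : T} (ha : a ≤ c) (hb : b ≤ c) (h : nodeLevel a ≤ nodeLevel b) :
    a ≤ b := by
  rcases τ.le_or_le_of_le ha hb with h' | h'
  · exact h'
  · exact (τ.eq_of_le_of_le hb ha (le_antisymm (τ.nodeLevel_le h') h)).ge

theorem nodeLevel_covBy {a b : T} (h : a ⋖ b) : nodeLevel b = nodeLevel a + 1 := by
  have : Set.Iio b = insert a (Set.Iio a) := by
    ext x
    constructor
    · intro hx
      rcases τ.le_or_le_of_le hx.le h.lt.le with h' | h'
      · exact (eq_or_lt_of_le h').imp id id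
      · rcases eq_or_lt_of_le h' with rfl | h'
        · exact Or.inl rfl
        · exact absurd hx (h.2 h')
    · rintro (rfl | hx)
      · exact h.lt
      · exact lt_trans hx h.lt
  rw [nodeLevel, this, Set.ncard_insert_of_notMem (by simp) (τ.finite_below a)]
  rfl

theorem exists_covBy_of_lt {a b : T} (h : a < b) : ∃ c, a ⋖ c ∧ c ≤ b := by
  have hfin : {x | a < x ∧ x ≤ b}.Finite :=
    ((τ.finite_below b).insert b).subset fun x hx => (eq_or_lt_of_le hx.2).imp id id
  obtain ⟨c, hc, hmin⟩ := hfin.exists_minimalFor id _ ⟨b, h, le_rfl⟩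
  refine ⟨c, ⟨hc.1, fun x hax hxc => ?_⟩, hc.2⟩
  exact absurd (hmin ⟨hax, hxc.le.trans hc.2⟩ hxc.le) (not_le_of_gt hxc)

theorem exists_covBy_below {b : T} (h : nodeLevel b ≠ 0) : ∃ a, a ⋖ b := by
  have hne : (Set.Iio b).Nonempty := Set.nonempty_of_ncard_ne_zero h
  obtain ⟨a, ha, hmax⟩ := (τ.finite_below b).exists_maximalFor id _ hne
  refine ⟨a, ha, fun x hax hxb => ?_⟩
  exact absurd (hmax hxb hax.le) (not_le_of_gt hax)

theorem exists_le_nodeLevel_eq {b : T} {k : ℕ} (h : k ≤ nodeLevel b) :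
    ∃ a ≤ b, nodeLevel a = k := by
  induction hn : nodeLevel b - k generalizing b with
  | zero => exact ⟨b, le_rfl, by omega⟩
  | succ n ih =>
    obtain ⟨a, ha⟩ := τ.exists_covBy_below (b := b) (by omega)
    have h1 := τ.nodeLevel_covBy ha
    obtain ⟨x, hx, hxk⟩ := ih (b := a) (by omega) (by omega)
    exact ⟨x, hx.trans ha.le, hxk⟩

theorem covBy_of_le_nodeLevel {a b : T} (h : a ≤ b) (hl : nodeLevel b = nodeLevel a + 1) : a ⋖ b := by
  obtain ⟨c, hc, hcb⟩ := τ.exists_covBy_of_lt (a := a) (b := b)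
    (lt_of_le_of_ne h fun e => by rw [e] at hl; omega)
  have : c = b := τ.eq_of_le_of_le hcb le_rfl (by rw [τ.nodeLevel_covBy hc, hl])
  rwa [← this]

theorem finite_level (k : ℕ) : {a : T | nodeLevel a = k}.Finite := by
  induction k with
  | zero => exact τ.finite_roots
  | succ k ih =>
    refine (ih.biUnion fun a _ => τ.finite_branching a).subset fun b hb => ?_
    obtain ⟨a, ha⟩ := τ.exists_covBy_below (b := b) (by rw [hb]; omega)
    have h1 := τ.nodeLevel_covBy ha
    simp only [Set.mem_iUnion]
    exact ⟨a, by rw [hb] at h1; exact (Nat.succ_injective h1).symm, ha⟩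

theorem finite_level_lt (k : ℕ) : {a : T | nodeLevel a < k}.Finite := by
  refine ((Set.finite_Iio k).biUnion fun j _ => τ.finite_level j).subset fun a ha => ?_
  simp only [Set.mem_iUnion]
  exact ⟨nodeLevel a, ha, rfl⟩

omit τ in
theorem nodeLevel_succOp {τ : STree T A} {a b : T} {p : List T} {e : A}
    (h : τ.succOp a p e = some b) : nodeLevel b = nodeLevel a + 1 :=
  τ.nodeLevel_covBy (τ.succ_spec _ _ _ _ h).1

namespace IsShapePreserving

variable {τ} {F : T → T} (hF : τ.IsShapePreserving F)

include hF

theorem lt_of_covBy {a b : T} (h : a ⋖ b) : F a < F b := by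
  obtain ⟨p, e, hp⟩ := τ.succ_constr a b h
  obtain ⟨d, hd, hdb⟩ := hF.weakly_succ_preserving _ _ _ _ hp
  exact (τ.succ_spec _ _ _ _ hd).1.lt.trans_le hdb

theorem nodeLevel_succ_le {a b : T} (h : nodeLevel b = nodeLevel a + 1) :
    nodeLevel (F a) < nodeLevel (F b) := by
  obtain ⟨a', ha'⟩ := τ.exists_covBy_below (b := b) (by omega)
  have h1 := τ.nodeLevel_covBy ha'
  rw [hF.level_preserving a a' (by omega)]
  exact τ.nodeLevel_lt (hF.lt_of_covBy ha')

theorem nodeLevel_add_le {a b : T} (h : nodeLevel a ≤ nodeLevel b) :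
    nodeLevel (F a) + (nodeLevel b - nodeLevel a) ≤ nodeLevel (F b) := by
  induction hn : nodeLevel b - nodeLevel a generalizing b with
  | zero => rw [hF.level_preserving a b (by omega)]; rfl
  | succ n ih =>
    obtain ⟨b', hb'⟩ := τ.exists_covBy_below (b := b) (by omega)
    have h1 := τ.nodeLevel_covBy hb'
    have h2 := ih (b := b') (by omega) (by omega)
    have h3 := hF.nodeLevel_succ_le (a := b') (b := b) h1
    omega

theorem nodeLevel_lt_nodeLevel {a b : T} (h : nodeLevel a < nodeLevel b) :
    nodeLevel (F a) < nodeLevel (F b) := by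
  have := hF.nodeLevel_add_le h.le; omega

theorem le_nodeLevel (a : T) : nodeLevel a ≤ nodeLevel (F a) := by
  obtain ⟨r, -, hr⟩ := τ.exists_le_nodeLevel_eq (Nat.zero_le (nodeLevel a))
  have := hF.nodeLevel_add_le (a := r) (b := a) (by omega)
  omega

theorem mono {a b : T} (h : a ≤ b) : F a ≤ F b := by
  induction hn : nodeLevel b - nodeLevel a generalizing b with
  | zero =>
    rw [τ.eq_of_le_of_le h le_rfl (by have := τ.nodeLevel_le h; omega)]
  | succ n ih =>
    obtain ⟨b', hb'⟩ := τ.exists_covBy_below (b := b) (by omega)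
    have h1 := τ.nodeLevel_covBy hb'
    have h2 := τ.le_of_nodeLevel_le h hb'.le (by omega)
    exact (ih h2 (by omega)).trans (hF.lt_of_covBy hb').le

/-- Induction on the level: roots lie below their images, and a successor is determined by its
predecessor, parameters and letter, all fixed by induction. Equality of levels turns each $\preceq$
into an equality. -/
theorem eq_self {n : ℕ} (h : ∀ a, nodeLevel a < n → nodeLevel (F a) = nodeLevel a) {a : T}
    (ha : nodeLevel a < n) : F a = a := by
  induction hk : nodeLevel a using Nat.strong_induction_on generalizing a with
  | _ k ih =>
    rcases Nat.eq_zero_or_pos k with rfl | h0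
    · exact (τ.eq_of_le_of_le (hF.root_le a a hk le_rfl) le_rfl (h a ha).symm).symm
    · obtain ⟨a', ha'⟩ := τ.exists_covBy_below (b := a) (by omega)
      have h1 := τ.nodeLevel_covBy ha'
      obtain ⟨p, e, hp⟩ := τ.succ_constr _ _ ha'
      obtain ⟨d, hd, hda⟩ := hF.weakly_succ_preserving _ _ _ _ hp
      have h2 : p.map F = p := by
        refine (List.map_congr_left fun q hq => ?_).trans (List.map_id p)
        have := (τ.succ_spec _ _ _ _ hp).2 q hq
        exact ih (nodeLevel q) (by omega) (by omega) rfl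
      rw [ih (nodeLevel a') (by omega) (by omega) rfl, h2, hp] at hd
      cases hd
      exact (τ.eq_of_le_of_le hda le_rfl (h a ha).symm).symm

omit hF in
theorem map_eq_self {n : ℕ} (h : ∀ a, nodeLevel a < n → F a = a) {a b : T} {p : List T} {e : A}
    (hp : τ.succOp a p e = some b) (ha : nodeLevel a ≤ n) : p.map F = p := by
  refine (List.map_congr_left fun q hq => ?_).trans (List.map_id p)
  exact h q (((τ.succ_spec _ _ _ _ hp).2 q hq).trans_le ha)

theorem succOp_le {n : ℕ} (h : ∀ a, nodeLevel a < n → F a = a) {a b : T} {p : List T} {e : A}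
    (hp : τ.succOp a p e = some b) (ha : nodeLevel a ≤ n) :
    ∃ d, τ.succOp (F a) p e = some d ∧ d ≤ F b := by
  have := hF.weakly_succ_preserving _ _ _ _ hp
  rwa [map_eq_self h hp ha] at this

theorem le_apply {n : ℕ} (h : ∀ a, nodeLevel a < n → F a = a) {a : T} (ha : nodeLevel a ≤ n) :
    a ≤ F a := by
  rcases Nat.eq_zero_or_pos (nodeLevel a) with h0 | h0
  · exact hF.root_le a a h0 le_rfl
  · obtain ⟨a', ha'⟩ := τ.exists_covBy_below (b := a) (by omega)
    have h1 := τ.nodeLevel_covBy ha'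
    obtain ⟨p, e, hp⟩ := τ.succ_constr _ _ ha'
    obtain ⟨d, hd, hda⟩ := hF.succOp_le h hp (by omega)
    rw [h a' (by omega), hp] at hd
    cases hd
    exact hda

theorem succOp_eq_of_nodeLevel {p : List T} {e : A} {a b : T} (hp : τ.succOp a p e = some b)
    (hl : nodeLevel (F b) = nodeLevel (F a) + 1) : τ.succOp (F a) (p.map F) e = some (F b) := by
  obtain ⟨d, hd, hda⟩ := hF.weakly_succ_preserving _ _ _ _ hp
  rw [hd, τ.eq_of_le_of_le hda le_rfl (by rw [hl]; exact nodeLevel_succOp hd)]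

end IsShapePreserving

end STree

namespace SMTree

variable (τ : SMTree T A)

include τ in
-- Duplication provides a function that skips only level `k + 1`, so level `k` is met. In particular
-- the tree has infinite height.
theorem exists_nodeLevel_eq (k : ℕ) : ∃ a : T, nodeLevel a = k := by
  obtain ⟨F, hF, hs, -⟩ := τ.duplication 0 (k + 1) (Nat.succ_pos k)
  have : k ∈ Set.range fun a => nodeLevel (F a) := by
    rw [hs]; simp
  obtain ⟨a, ha⟩ := this
  obtain ⟨b, -, hb⟩ := τ.exists_le_nodeLevel_eq (b := F a) (k := k) ha.ge
  exact ⟨b, hb⟩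

variable {τ}

theorem exists_levelMap {F : T → T} (hF : F ∈ τ.M) :
    ∃ f : ℕ → ℕ, StrictMono f ∧ ∀ a, nodeLevel (F a) = f (nodeLevel a) := by
  choose r hr using τ.exists_nodeLevel_eq
  refine ⟨fun k => nodeLevel (F (r k)), fun i j hij => ?_, fun a => ?_⟩
  · exact (τ.shape_preserving F hF).nodeLevel_lt_nodeLevel (by rw [hr, hr]; exact hij)
  · exact (τ.shape_preserving F hF).level_preserving _ _ (hr _).symm

include τ in
theorem range_nodeLevel {F : T → T} {f : ℕ → ℕ} (h : ∀ a, nodeLevel (F a) = f (nodeLevel a)) :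
    Set.range (fun a => nodeLevel (F a)) = Set.range f := by
  ext k
  constructor
  · rintro ⟨a, rfl⟩; exact ⟨nodeLevel a, (h a).symm⟩
  · rintro ⟨j, rfl⟩
    obtain ⟨a, ha⟩ := τ.exists_nodeLevel_eq j
    exact ⟨a, by simp only [h, ha]⟩

/-- The induced map on levels is strictly increasing, hence determined by its range. -/
theorem nodeLevel_of_skipsOnlyLevel {F : T → T} (hF : F ∈ τ.M) {m : ℕ} (h : SkipsOnlyLevel F m)
    (a : T) : nodeLevel (F a) = if nodeLevel a < m then nodeLevel a else nodeLevel a + 1 := by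
  obtain ⟨f, hf, hlev⟩ := exists_levelMap hF
  have hg : StrictMono fun k : ℕ => if k < m then k else k + 1 := by
    intro i j hij
    simp only
    split_ifs <;> omega
  have : f = fun k : ℕ => if k < m then k else k + 1 := by
    rw [← hf.range_inj hg, ← range_nodeLevel (τ := τ) hlev, h]
    ext k
    simp only [Set.mem_compl_iff, Set.mem_singleton_iff, Set.mem_range]
    constructor
    · intro hk
      by_cases h' : k < m
      · exact ⟨k, if_pos h'⟩
      · exact ⟨k - 1, by rw [if_neg (by omega)]; omega⟩
    · rintro ⟨j, rfl⟩
      split_ifs <;> omega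
  rw [hlev, this]

theorem apply_eq_self_of_skipsOnlyLevel {F : T → T} (hF : F ∈ τ.M) {m : ℕ}
    (h : SkipsOnlyLevel F m) {a : T} (ha : nodeLevel a < m) : F a = a :=
  (τ.shape_preserving F hF).eq_self (n := m) (fun b hb => by
    rw [nodeLevel_of_skipsOnlyLevel hF h, if_pos hb]) ha

/-- Splitting off the topmost skipped level. -/
theorem exists_decomposition_top {F : T → T} (hF : F ∈ τ.M) {n m : ℕ}
    (hm : ∀ a, nodeLevel a = n → nodeLevel (F a) = m + 1)
    (hs : ∀ a, nodeLevel a < n → nodeLevel (F a) < m) :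
    ∃ F₁ ∈ τ.M, ∃ F₂ ∈ τ.M, SkipsOnlyLevel F₂ m ∧ (∀ a, nodeLevel a ≤ n → F₂ (F₁ a) = F a) ∧
      (∀ a, nodeLevel a = n → nodeLevel (F₁ a) = m) ∧ ∀ a, nodeLevel a < n → F₁ a = F a := by
  obtain ⟨f, hf, hlev⟩ := exists_levelMap hF
  obtain ⟨r, hr⟩ := τ.exists_nodeLevel_eq n
  have hskip : SkipsLevel F m := by
    rintro ⟨a, ha⟩
    simp only at ha
    rcases Nat.lt_or_ge (nodeLevel a) n with h | h
    · exact absurd (hs a h) (by omega)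
    · have h1 := hf.monotone h
      rw [← hlev, ha, ← hr, ← hlev, hm r hr] at h1
      omega
  obtain ⟨F₁, hF₁, F₂, hF₂, hsk, hcomp⟩ := τ.decomposition F hF n m ⟨r, hr, hm r hr⟩ hskip
  have hl := nodeLevel_of_skipsOnlyLevel hF₂ hsk
  have h1 : ∀ a, nodeLevel a = n → nodeLevel (F₁ a) = m := by
    intro a ha
    have h2 := hl (F₁ a)
    rw [hcomp a ha.le, hm a ha] at h2
    split_ifs at h2 <;> omega
  refine ⟨F₁, hF₁, F₂, hF₂, hsk, hcomp, h1, fun a ha => ?_⟩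
  rw [← hcomp a ha.le]
  refine (apply_eq_self_of_skipsOnlyLevel hF₂ hsk ?_).symm
  rw [← h1 r hr]
  exact (τ.shape_preserving _ hF₁).nodeLevel_lt_nodeLevel (by omega)

/-- As long as a level between the images of levels `n` and `n + 1` is skipped, the topmost one can
be split off. This lowers the image of level `n + 1` and changes nothing up to level `n`. -/
theorem exists_eq_below_nodeLevel_succ {F : T → T} (hF : F ∈ τ.M) (n : ℕ) :
    ∃ G ∈ τ.M, (∀ a, nodeLevel a ≤ n → G a = F a) ∧
      ∀ a b, nodeLevel a = n → nodeLevel b = n + 1 → nodeLevel (G b) = nodeLevel (F a) + 1 := by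
  obtain ⟨r, hr⟩ := τ.exists_nodeLevel_eq n
  obtain ⟨s, hs⟩ := τ.exists_nodeLevel_eq (n + 1)
  induction hk : nodeLevel (F s) using Nat.strong_induction_on generalizing F with
  | _ k ih =>
    have hsp := τ.shape_preserving F hF
    have h1 : nodeLevel (F r) < nodeLevel (F s) := hsp.nodeLevel_lt_nodeLevel (by omega)
    by_cases h2 : nodeLevel (F s) = nodeLevel (F r) + 1
    · refine ⟨F, hF, fun _ _ => rfl, fun a b ha hb => ?_⟩
      rw [hsp.level_preserving a r (by omega), hsp.level_preserving b s (by omega), h2]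
    · obtain ⟨F₁, hF₁, F₂, hF₂, hsk, hcomp, h3, h4⟩ := exists_decomposition_top hF (n := n + 1)
        (m := nodeLevel (F s) - 1)
        (fun a ha => by rw [hsp.level_preserving a s (by omega)]; omega)
        (fun a ha => by
          have := hsp.nodeLevel_add_le (a := a) (b := r) (by omega)
          omega)
      obtain ⟨G, hG, hG1, hG2⟩ := ih (nodeLevel (F₁ s)) (by rw [h3 s hs]; omega) hF₁ rfl
      refine ⟨G, hG, fun a ha => by rw [hG1 a ha, h4 a (by omega)], fun a b ha hb => ?_⟩
      rw [hG2 a b ha hb, h4 a (by omega)]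

/-- The gaps after levels `n`, `n + 1`, … are closed one after another, and the resulting functions
stabilise on each level, so closure of `M` under limits applies. -/
theorem exists_canonicalExtension {F : T → T} (hF : F ∈ τ.M) (n : ℕ) :
    ∃ G ∈ τ.M, (∀ a, nodeLevel a ≤ n → G a = F a) ∧
      ∀ i a b, nodeLevel a = n → nodeLevel b = n + i → nodeLevel (G b) = nodeLevel (F a) + i := by
  choose g hgM hg hgs using fun (F : τ.M) (n : ℕ) => exists_eq_below_nodeLevel_succ F.2 n
  let H : ℕ → τ.M := fun i => Nat.rec ⟨F, hF⟩ (fun i F => ⟨g F (n + i), hgM F (n + i)⟩) i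
  have hH : ∀ i a, nodeLevel a ≤ n + i → (H (i + 1)).1 a = (H i).1 a := fun i a ha =>
    hg (H i) (n + i) a ha
  have hH' : ∀ i j, i ≤ j → ∀ a, nodeLevel a ≤ n + i → (H j).1 a = (H i).1 a := by
    intro i j hij
    induction j, hij using Nat.le_induction with
    | base => exact fun _ _ => rfl
    | succ j hj ih => intro a ha; rw [hH j a (by omega), ih a ha]
  obtain ⟨G, hG, hGH⟩ := τ.limit_mem (fun i => (H i).1) (fun i => (H i).2)
    fun i a ha => (hH i a (by omega)).symm
  have hGi : ∀ i a, nodeLevel a ≤ n + i → G a = (H i).1 a := by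
    intro i a ha
    rw [hGH (n + i) a ha, hH' i (n + i) (by omega) a ha]
  refine ⟨G, hG, fun a ha => hGi 0 a ha, fun i => ?_⟩
  induction i with
  | zero =>
    intro a b ha hb
    rw [hGi 0 b hb.le]
    exact (τ.shape_preserving F hF).level_preserving _ _ (by omega)
  | succ i ih =>
    intro a b ha hb
    obtain ⟨c, hc⟩ := τ.exists_nodeLevel_eq (n + i)
    have h1 := hgs (H i) (n + i) c b hc hb
    rw [hGi (i + 1) b (by omega)]
    rw [← hGi i c hc.le, ih a c ha hc] at h1
    rw [← add_assoc]
    exact h1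

theorem restrictBelow_eq_iff {F G : T → T} {k : ℕ} :
    restrictBelow F k = restrictBelow G k ↔ ∀ a, nodeLevel a < k → F a = G a := by
  constructor
  · intro h a ha
    have := congrFun h a
    simpa [restrictBelow, ha] using this
  · intro h
    funext a
    unfold restrictBelow
    split_ifs with ha
    · rw [h a ha]
    · rfl

theorem canonicalExtension_spec {F : T → T} (hF : F ∈ τ.M) (n : ℕ) {G : T → T}
    (hGdef : G = τ.canonicalExtension (restrictBelow F (n + 1)) n) :
    G ∈ τ.M ∧ (∀ a, nodeLevel a ≤ n → G a = F a) ∧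
      ∀ i a b, nodeLevel a = n → nodeLevel b = n + i → nodeLevel (G b) = nodeLevel (F a) + i := by
  have hex : ∃ G, τ.IsCanonicalExtension (restrictBelow F (n + 1)) n G := by
    obtain ⟨G, hG, h1, h2⟩ := exists_canonicalExtension hF n
    refine ⟨G, hG, restrictBelow_eq_iff.2 fun a ha => h1 a (by omega), fun a k ha hk => ?_⟩
    rw [h1 a ha.le] at hk
    obtain ⟨b, hb⟩ := τ.exists_nodeLevel_eq (n + (k - nodeLevel (F a)))
    exact ⟨b, by rw [h2 _ a b ha hb]; omega⟩
  have hspec : τ.IsCanonicalExtension (restrictBelow F (n + 1)) n G := by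
    rw [hGdef, canonicalExtension, dif_pos hex]
    exact hex.choose_spec
  obtain ⟨hG, hres, hlev⟩ := hspec
  have h1 : ∀ a, nodeLevel a ≤ n → G a = F a := fun a ha =>
    restrictBelow_eq_iff.1 hres a (by omega)
  refine ⟨hG, h1, fun i => ?_⟩
  obtain ⟨f, hf, hfl⟩ := exists_levelMap hG
  induction i with
  | zero =>
    intro a b ha hb
    rw [h1 b hb.le]
    exact (τ.shape_preserving F hF).level_preserving _ _ (by omega)
  | succ i ih =>
    intro a b ha hb
    obtain ⟨c, hc⟩ := τ.exists_nodeLevel_eq (n + i)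
    have h2 := ih a c ha hc
    obtain ⟨d, hd⟩ := hlev a (nodeLevel (F a) + i + 1) ha (by rw [h1 a ha.le]; omega)
    rw [hfl, hc] at h2
    rw [hfl] at hd
    have h3 : n + i < nodeLevel d := hf.lt_iff_lt.1 (by omega)
    have h4 : f (n + (i + 1)) ≤ f (nodeLevel d) := hf.monotone (by omega)
    have h5 : f (n + i) < f (n + (i + 1)) := hf (by omega)
    rw [hfl, hb]
    omega

/-- Members of `M` factor through every intermediate level. -/
theorem exists_decomposition {F : T → T} (hF : F ∈ τ.M) {n N m : ℕ} (hid : ∀ a, nodeLevel a < n → F a = a)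
    (hm : ∀ a, nodeLevel a = n → nodeLevel (F a) = m) (hnN : n ≤ N) (hN : N ≤ m) :
    ∃ F₁ ∈ τ.M, (∀ a, nodeLevel a < n → F₁ a = a) ∧ (∀ a, nodeLevel a = n → nodeLevel (F₁ a) = N) ∧
      ∀ a, nodeLevel a = n → F₁ a ≤ F a := by
  induction m, hN using Nat.le_induction generalizing F with
  | base => exact ⟨F, hF, hid, hm, fun _ _ => le_rfl⟩
  | succ m hNm ih =>
    -- Level `m` is skipped: lower levels than `n` are fixed and `n ≤ N ≤ m`.
    obtain ⟨F₁, hF₁, F₂, hF₂, hsk, hcomp, h1, h2⟩ := exists_decomposition_top hF hm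
      fun a ha => by rw [hid a ha]; omega
    obtain ⟨G, hG, hG1, hG2, hG3⟩ := ih hF₁ (fun a ha => by rw [h2 a ha, hid a ha]) h1
    refine ⟨G, hG, hG1, hG2, fun a ha => (hG3 a ha).trans ?_⟩
    rw [← hcomp a ha.le]
    exact (τ.shape_preserving _ hF₂).le_apply
      (fun b hb => apply_eq_self_of_skipsOnlyLevel hF₂ hsk hb) (h1 a ha).le

end SMTree

end Levels

/-! ### One-step approximations as edges of a path system -/

section FatEdges

variable {T A : Type*} [PartialOrder T]

theorem STree.IsShapePreserving.succOp_apply {τ : STree T A} {F : T → T}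
    (hF : τ.IsShapePreserving F) {n : ℕ} (hid : ∀ a, nodeLevel a < n → F a = a) {a b : T}
    {p : List T} {x : A} (hp : τ.succOp a p x = some b) (ha : nodeLevel a ≤ n)
    (hl : nodeLevel (F b) = nodeLevel (F a) + 1) : τ.succOp (F a) p x = some (F b) := by
  have := hF.succOp_eq_of_nodeLevel hp hl
  rwa [map_eq_self hid hp ha] at this

/-- The nodes of level `k`. -/
def levelSet (T : Type*) [PartialOrder T] (k : ℕ) : Set T := {a | nodeLevel a = k}

/-- The immediate successors of the nodes in `X`. -/
def succSet (X : Set T) : Set T := {b | ∃ a ∈ X, a ⋖ b}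

theorem succSet_mono {X Y : Set T} (h : X ⊆ Y) : succSet X ⊆ succSet Y :=
  fun _ ⟨a, ha, hab⟩ => ⟨a, h ha, hab⟩

/-- One step of a fat subtree: a member of `AM^src_1(top)`. -/
@[ext]
structure FatEdge (τ : SMTree T A) where
  src : ℕ
  top : ℕ
  val : T → Option T
  mem : val ∈ τ.AMApproxTo src 1 top

namespace FatEdge

variable {τ : SMTree T A}

/-- The canonical extension of a one-step approximation. -/
noncomputable def ext' (e : FatEdge τ) : T → T := τ.canonicalExtension e.val e.src

/-- The cut point that follows the edge. -/
def tgt (e : FatEdge τ) : ℕ := e.top + 1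

theorem ext'_spec (e : FatEdge τ) : e.ext' ∈ τ.M ∧ (∀ a, nodeLevel a < e.src → e.ext' a = a) ∧
    (∀ a, e.src ≤ nodeLevel a → nodeLevel (e.ext' a) = e.top + (nodeLevel a - e.src)) ∧
    e.val = restrictBelow e.ext' (e.src + 1) := by
  obtain ⟨⟨F, hF, hval⟩, r, s, hr, hrs, hs⟩ := e.mem
  obtain ⟨h1, h2, h3⟩ := SMTree.canonicalExtension_spec hF.1 e.src (G := e.ext') (by
    rw [← hval]; rfl)
  have hFr : F r = s := by
    rw [hval, restrictBelow, if_pos (by omega)] at hrs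
    exact Option.some.inj hrs
  refine ⟨h1, fun a ha => by rw [h2 a ha.le, hF.2 a ha], fun a ha => ?_, ?_⟩
  · rw [h3 (nodeLevel a - e.src) r a (by omega) (by omega), hFr, hs]
  · rw [hval]
    exact SMTree.restrictBelow_eq_iff.2 fun a ha => (h2 a (by omega)).symm

theorem ext'_mem (e : FatEdge τ) : e.ext' ∈ τ.M := e.ext'_spec.1

theorem sp_ext' (e : FatEdge τ) : τ.toSTree.IsShapePreserving e.ext' :=
  τ.shape_preserving _ e.ext'_mem

theorem ext'_eq_self (e : FatEdge τ) {a : T} (h : nodeLevel a < e.src) : e.ext' a = a :=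
  e.ext'_spec.2.1 a h

theorem nodeLevel_ext' (e : FatEdge τ) {a : T} (h : e.src ≤ nodeLevel a) :
    nodeLevel (e.ext' a) = e.top + (nodeLevel a - e.src) := e.ext'_spec.2.2.1 a h

theorem val_eq (e : FatEdge τ) : e.val = restrictBelow e.ext' (e.src + 1) := e.ext'_spec.2.2.2

theorem src_le_top (e : FatEdge τ) : e.src ≤ e.top := by
  obtain ⟨r, hr⟩ := τ.exists_nodeLevel_eq e.src
  have h1 := e.nodeLevel_ext' hr.ge
  have h2 := e.sp_ext'.le_nodeLevel r
  omega

theorem le_ext' (e : FatEdge τ) {a : T} (h : nodeLevel a = e.src) : a ≤ e.ext' a :=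
  e.sp_ext'.le_apply (fun _ hb => e.ext'_eq_self hb) h.le

theorem succOp_ext' (e : FatEdge τ) {a b : T} {p : List T} {x : A} (h : nodeLevel a = e.src)
    (hp : τ.succOp a p x = some b) : τ.succOp (e.ext' a) p x = some (e.ext' b) := by
  have h1 := STree.nodeLevel_succOp hp
  refine e.sp_ext'.succOp_apply (fun _ hb => e.ext'_eq_self hb) hp h.le ?_
  rw [e.nodeLevel_ext' h.ge, e.nodeLevel_ext' (by omega)]
  omega

theorem eq_of_ext' {e e' : FatEdge τ} (hs : e.src = e'.src)
    (h : ∀ a, nodeLevel a = e.src → e.ext' a = e'.ext' a) : e = e' := by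
  have hv : e.val = e'.val := by
    rw [e.val_eq, e'.val_eq, ← hs, SMTree.restrictBelow_eq_iff]
    intro a ha
    rcases Nat.lt_or_ge (nodeLevel a) e.src with h1 | h1
    · rw [e.ext'_eq_self h1, e'.ext'_eq_self (by omega)]
    · exact h a (by omega)
  obtain ⟨r, hr⟩ := τ.exists_nodeLevel_eq e.src
  have ht : e.top = e'.top := by
    have h1 := e.nodeLevel_ext' hr.ge
    have h2 := e'.nodeLevel_ext' (a := r) (by omega)
    rw [h r hr] at h1
    omega
  exact FatEdge.ext hs ht hv

/-- The edge given by the restriction of a member of `M`. -/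
noncomputable def ofFun (F : T → T) (c m : ℕ) (hF : F ∈ τ.M) (hid : ∀ a, nodeLevel a < c → F a = a)
    (hm : ∀ a, nodeLevel a = c → nodeLevel (F a) = m) : FatEdge τ where
  src := c
  top := m
  val := restrictBelow F (c + 1)
  mem := by
    obtain ⟨r, hr⟩ := τ.exists_nodeLevel_eq c
    exact ⟨⟨F, ⟨hF, hid⟩, rfl⟩, r, F r, by omega, if_pos (by omega), hm r hr⟩

theorem ofFun_ext' {F : T → T} {c m : ℕ} {hF : F ∈ τ.M} {hid : ∀ a, nodeLevel a < c → F a = a}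
    {hm : ∀ a, nodeLevel a = c → nodeLevel (F a) = m} {a : T} (ha : nodeLevel a = c) :
    (ofFun F c m hF hid hm).ext' a = F a := by
  have := (ofFun F c m hF hid hm).val_eq
  exact (SMTree.restrictBelow_eq_iff.1 this a (by omega)).symm

/-- The lift of a set of nodes along a path of edges. -/
noncomputable def liftList (l : List (FatEdge τ)) (X : Set T) : Set T :=
  l.foldl (fun X e => e.ext' '' succSet X) X

theorem liftList_cons (e : FatEdge τ) (l : List (FatEdge τ)) (X : Set T) :
    liftList (e :: l) X = liftList l (e.ext' '' succSet X) := rfl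

theorem liftList_append (l l' : List (FatEdge τ)) (X : Set T) :
    liftList (l ++ l') X = liftList l' (liftList l X) := List.foldl_append

theorem liftList_mono (l : List (FatEdge τ)) {X Y : Set T} (h : X ⊆ Y) :
    liftList l X ⊆ liftList l Y := by
  induction l generalizing X Y with
  | nil => exact h
  | cons e l ih => exact ih (Set.image_mono (succSet_mono h))

/-- Finite paths of edges. -/
abbrev IsPath (m : ℕ) (l : List (FatEdge τ)) (n : ℕ) : Prop := IsPathBetween src tgt m l n

theorem liftList_level {l : List (FatEdge τ)} {m n : ℕ} (h : IsPath m l n) {X : Set T}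
    (hX : X ⊆ levelSet T m) : liftList l X ⊆ levelSet T n := by
  induction l generalizing m X with
  | nil => cases h; exact hX
  | cons e l ih =>
    obtain ⟨rfl, h2⟩ := h
    refine ih h2 ?_
    rintro _ ⟨b, ⟨a, ha, hab⟩, rfl⟩
    have h1 := τ.nodeLevel_covBy hab
    have h3 : nodeLevel a = e.src := hX ha
    change nodeLevel (e.ext' b) = e.top + 1
    rw [e.nodeLevel_ext' (by omega)]
    omega

theorem exists_mem_liftList_singleton {l : List (FatEdge τ)} {m n : ℕ} (h : IsPath m l n)
    {X : Set T} (hX : X ⊆ levelSet T m) {y : T} (hy : y ∈ liftList l X) :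
    ∃ a ∈ X, a ≤ y ∧ y ∈ liftList l {a} := by
  induction l generalizing m X with
  | nil => exact ⟨y, hy, le_rfl, rfl⟩
  | cons e l ih =>
    obtain ⟨rfl, h2⟩ := h
    have h3 : e.ext' '' succSet X ⊆ levelSet T e.tgt :=
      liftList_level (l := [e]) ⟨rfl, rfl⟩ hX
    obtain ⟨_, ⟨b, ⟨a, ha, hab⟩, rfl⟩, hby, hy'⟩ := ih h2 h3 hy
    refine ⟨a, ha, ((e.le_ext' (hX ha)).trans (e.sp_ext'.mono hab.le)).trans hby, ?_⟩
    refine liftList_mono l ?_ hy'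
    rintro _ rfl
    exact ⟨b, ⟨a, rfl, hab⟩, rfl⟩

/-- Each node of a lift comes from a node of the starting level below it, and that node is unique.
-/
theorem mem_liftList_of_le {l : List (FatEdge τ)} {m n : ℕ} (h : IsPath m l n)
    {X : Set T} {a y : T} (haX : a ∈ X) (ham : nodeLevel a = m) (hay : a ≤ y)
    (hy : y ∈ liftList l (levelSet T m)) : y ∈ liftList l X := by
  obtain ⟨b, hb, hby, hy'⟩ := exists_mem_liftList_singleton h subset_rfl hy
  have : a = b := τ.eq_of_le_of_le hay hby (by rw [ham, hb])
  subst this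
  exact liftList_mono l (Set.singleton_subset_iff.2 haX) hy'

/-- The edge `e` is spanned by the path `l`. -/
def Spanned (e : FatEdge τ) (l : List (FatEdge τ)) : Prop :=
  IsPath e.src l e.tgt ∧ e.ext' '' succSet (levelSet T e.src) ⊆ liftList l (levelSet T e.src)

theorem src_lt_tgt (e : FatEdge τ) : e.src < e.tgt := Nat.lt_succ_of_le e.src_le_top

theorem Spanned.subst {e d : FatEdge τ} {l l₁ l₂ : List (FatEdge τ)}
    (h : Spanned e (l₁ ++ d :: l₂)) (h' : Spanned d l) : Spanned e (l₁ ++ l ++ l₂) := by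
  obtain ⟨k, hk, rfl, h2⟩ := isPathBetween_append.1 h.1
  refine ⟨isPathBetween_append.2 ⟨_, isPathBetween_append.2 ⟨_, hk, h'.1⟩, h2⟩, ?_⟩
  refine h.2.trans ?_
  rw [liftList_append, liftList_cons, liftList_append, liftList_append]
  apply liftList_mono
  have hL : liftList l₁ (levelSet T e.src) ⊆ levelSet T d.src := liftList_level hk subset_rfl
  rintro _ ⟨b, ⟨a, ha, hab⟩, rfl⟩
  refine mem_liftList_of_le h'.1 ha (hL ha) ((d.le_ext' (hL ha)).trans (d.sp_ext'.mono hab.le)) ?_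
  exact h'.2 ⟨b, ⟨a, hL ha, hab⟩, rfl⟩

/-- An edge is determined by a map between two finite sets: nodes of level at most the source, and
nodes below the target level. -/
theorem finite_src_tgt (m n : ℕ) : {e : FatEdge τ | e.src = m ∧ e.tgt = n}.Finite := by
  have hf1 : Finite {a : T // nodeLevel a < m + 1} := τ.finite_level_lt (m + 1)
  have hf2 : Finite {a : T // nodeLevel a < n} := τ.finite_level_lt n
  let f : {e : FatEdge τ | e.src = m ∧ e.tgt = n} →
      ({a : T // nodeLevel a < m + 1} → {a : T // nodeLevel a < n}) := fun e a => ⟨e.1.ext' a.1, by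
    obtain ⟨⟨e, rfl, rfl⟩, a, ha⟩ := e, a
    have h1 := e.src_le_top
    simp only [tgt]
    rcases Nat.lt_or_ge (nodeLevel a) e.src with h | h
    · rw [e.ext'_eq_self h]; omega
    · rw [e.nodeLevel_ext' h]; omega⟩
  refine Finite.of_injective f fun e e' h => Subtype.ext ?_
  refine eq_of_ext' (e.2.1.trans e'.2.1.symm) fun a ha => ?_
  have ha' : nodeLevel a < m + 1 := by rw [ha, e.2.1]; omega
  exact congrArg Subtype.val (congrFun h ⟨a, ha'⟩)

end FatEdge

/-- The path system of one-step approximations of an `(S, M)`-tree. -/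
def SMTree.pathSystem (τ : SMTree T A) : PathSystem (FatEdge τ) where
  src := FatEdge.src
  tgt := FatEdge.tgt
  sp := FatEdge.Spanned
  src_lt_tgt := FatEdge.src_lt_tgt
  isPath_of_sp _ _ h := h.1
  sp_self _ := ⟨⟨rfl, rfl⟩, subset_rfl⟩
  sp_subst _ _ _ _ _ h h' := h.subst h'
  finite_edges := FatEdge.finite_src_tgt

end FatEdges

/-! ### Copying levels, and maps along lifts -/

section CopyingLevels

variable {T A : Type*} [PartialOrder T]

/-- The successor of level `ℓ + 1` below `y` is obtained by the parameters `p` and the letter `x`. -/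
def STree.LetterAt (τ : STree T A) (y : T) (ℓ : ℕ) (p : List T) (x : A) : Prop :=
  ∃ z d, nodeLevel z = ℓ ∧ τ.succOp z p x = some d ∧ d ≤ y

theorem STree.LetterAt.mono {τ : STree T A} {y y' : T} {ℓ : ℕ} {p : List T} {x : A}
    (h : τ.LetterAt y ℓ p x) (hy : y ≤ y') : τ.LetterAt y' ℓ p x := by
  obtain ⟨z, d, hz, hd, hdy⟩ := h
  exact ⟨z, d, hz, hd, hdy.trans hy⟩

theorem STree.exists_letterAt (τ : STree T A) {y : T} {ℓ : ℕ} (h : ℓ < nodeLevel y) :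
    ∃ p x, τ.LetterAt y ℓ p x := by
  obtain ⟨d, hdy, hd⟩ := τ.exists_le_nodeLevel_eq (b := y) (k := ℓ + 1) h
  obtain ⟨z, hz⟩ := τ.exists_covBy_below (b := d) (by omega)
  have h1 := τ.nodeLevel_covBy hz
  obtain ⟨p, x, hp⟩ := τ.succ_constr _ _ hz
  exact ⟨p, x, z, d, by omega, hp, hdy⟩

open Classical in
/-- A member of `M` that skips only level `m` and copies the successors taken at level `ℓ`. -/
noncomputable def SMTree.dup (τ : SMTree T A) (ℓ m : ℕ) : T → T :=
  if h : ℓ < m then (τ.duplication ℓ m h).choose else id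

section dup

variable {τ : SMTree T A} {ℓ m : ℕ}

theorem SMTree.dup_mem (h : ℓ < m) : τ.dup ℓ m ∈ τ.M := by
  rw [SMTree.dup, dif_pos h]; exact (τ.duplication ℓ m h).choose_spec.1

theorem SMTree.dup_skips (h : ℓ < m) : SkipsOnlyLevel (τ.dup ℓ m) m := by
  rw [SMTree.dup, dif_pos h]; exact (τ.duplication ℓ m h).choose_spec.2.1

theorem SMTree.succOp_dup (h : ℓ < m) {y : T} (hy : nodeLevel y = m) {p : List T} {x : A}
    (hl : τ.LetterAt y ℓ p x) : τ.succOp y p x = some (τ.dup ℓ m y) := by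
  obtain ⟨z, d, hz, hd, hdy⟩ := hl
  rw [SMTree.dup, dif_pos h]
  exact (τ.duplication ℓ m h).choose_spec.2.2 z y p x d hz hy hd hdy

/-- Both sides are the successor of `e.ext' z` given by the parameters and letter used at level `ℓ`
below `z`. Copying just below the next cut is thus the same as copying at the cut and then applying
the edge. -/
theorem FatEdge.dup_ext' (e : FatEdge τ) (h : ℓ < e.src) {z : T} (hz : nodeLevel z = e.src) :
    τ.dup ℓ e.top (e.ext' z) = e.ext' (τ.dup ℓ e.src z) := by
  obtain ⟨p, x, hp⟩ := τ.exists_letterAt (y := z) (ℓ := ℓ) (by omega)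
  have h1 := e.succOp_ext' hz (SMTree.succOp_dup h hz hp)
  have h2 := SMTree.succOp_dup (m := e.top) (h.trans_le e.src_le_top)
    (by rw [e.nodeLevel_ext' hz.ge, hz, Nat.sub_self, Nat.add_zero]) (hp.mono (e.le_ext' hz))
  exact Option.some.inj (h2.symm.trans h1)

end dup

open PathSystem

/-- The lift of the full cut level of index `i` to the cut level of index `k`. -/
noncomputable def liftSeg {τ : SMTree T A} (U : ℕ → FatEdge τ) (i k : ℕ) : Set T :=
  FatEdge.liftList (seg U i k) (levelSet T (U i).src)

/-- The function `h` in `M` maps the cut level of index `i` to the cut level of index `k`, along the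
lifts in `U`. -/
structure IsLiftMap {τ : SMTree T A} (U : ℕ → FatEdge τ) (i k : ℕ) (h : T → T) : Prop where
  mem : h ∈ τ.M
  eq_self : ∀ a, nodeLevel a < (U i).src → h a = a
  mem_lift : ∀ a, nodeLevel a = (U i).src → h a ∈ liftSeg U i k

variable {τ : SMTree T A} {U : ℕ → FatEdge τ}

theorem liftSeg_succ {i k : ℕ} (h : i ≤ k) :
    liftSeg U i (k + 1) = (U k).ext' '' succSet (liftSeg U i k) := by
  rw [liftSeg, seg_succ_right U h, FatEdge.liftList_append]
  rfl

theorem liftSeg_self (i : ℕ) : liftSeg U i i = levelSet T (U i).src := by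
  rw [liftSeg, seg_self]; rfl

namespace PathSystem.IsInf

variable (hU : τ.pathSystem.IsInf U)

include hU

theorem src_succ (i : ℕ) : (U (i + 1)).src = (U i).top + 1 := hU.2 i

theorem src_mono {i j : ℕ} (h : i ≤ j) : (U i).src ≤ (U j).src := hU.strictMono.monotone h

theorem nodeLevel_liftSeg {i k : ℕ} (h : i ≤ k) {y : T} (hy : y ∈ liftSeg U i k) :
    nodeLevel y = (U k).src :=
  FatEdge.liftList_level (hU.isPath_seg h) subset_rfl hy

omit hU in
theorem _root_.liftSeg_eq {i j k : ℕ} (hij : i ≤ j) (hjk : j ≤ k) :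
    liftSeg U i k = FatEdge.liftList (seg U j k) (liftSeg U i j) := by
  rw [liftSeg, ← seg_append U hij hjk, FatEdge.liftList_append]
  rfl

theorem mem_liftSeg_of_le {i j k : ℕ} (hij : i ≤ j) (hjk : j ≤ k) {a y : T}
    (ha : a ∈ liftSeg U i j) (hay : a ≤ y) (hy : y ∈ liftSeg U j k) : y ∈ liftSeg U i k := by
  rw [liftSeg_eq hij hjk]
  exact FatEdge.mem_liftList_of_le (hU.isPath_seg hjk) ha (hU.nodeLevel_liftSeg hij ha) hay hy

theorem exists_le_mem_liftSeg {i j k : ℕ} (hij : i ≤ j) (hjk : j ≤ k) {y : T}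
    (hy : y ∈ liftSeg U i k) : ∃ a ∈ liftSeg U i j, a ≤ y := by
  rw [liftSeg_eq hij hjk] at hy
  obtain ⟨a, ha, hay, -⟩ := FatEdge.exists_mem_liftList_singleton (hU.isPath_seg hjk)
    (fun a ha => hU.nodeLevel_liftSeg hij ha) hy
  exact ⟨a, ha, hay⟩

theorem ext'_le_of_mem_liftSeg {i k : ℕ} (h : i < k) {a y : T} (ha : nodeLevel a = (U i).src)
    (hay : a ≤ y) (hy : y ∈ liftSeg U i k) : (U i).ext' a ≤ y := by
  obtain ⟨z, hz, hzy⟩ := hU.exists_le_mem_liftSeg (Nat.le_succ i) h hy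
  rw [liftSeg_succ le_rfl, liftSeg_self] at hz
  obtain ⟨b, ⟨a', ha', hab⟩, rfl⟩ := hz
  have h1 := (U i).sp_ext'.mono hab.le
  have h2 : a' = a := τ.eq_of_le_of_le (((U i).le_ext' ha').trans (h1.trans hzy)) hay
    (ha'.trans ha.symm)
  rw [← h2]
  exact h1.trans hzy

end PathSystem.IsInf

namespace IsLiftMap

variable {i j k : ℕ} {g h : T → T}

theorem le_apply (hh : IsLiftMap U i k h) {a : T} (ha : nodeLevel a = (U i).src) : a ≤ h a :=
  (τ.shape_preserving _ hh.mem).le_apply hh.eq_self ha.le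

theorem nodeLevel_apply (hh : IsLiftMap U i k h) (hU : τ.pathSystem.IsInf U) (hik : i ≤ k) {a : T}
    (ha : nodeLevel a = (U i).src) : nodeLevel (h a) = (U k).src :=
  hU.nodeLevel_liftSeg hik (hh.mem_lift a ha)

theorem id (U : ℕ → FatEdge τ) (i : ℕ) : IsLiftMap U i i id :=
  ⟨τ.id_mem, fun _ _ => rfl, fun a ha => by rw [liftSeg_self]; exact ha⟩

theorem comp (hU : τ.pathSystem.IsInf U) (hij : i ≤ j) (hjk : j ≤ k) (hg : IsLiftMap U j k g)
    (hh : IsLiftMap U i j h) : IsLiftMap U i k (g ∘ h) := by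
  refine ⟨τ.comp_mem _ hg.mem _ hh.mem, fun a ha => ?_, fun a ha => ?_⟩
  · rw [Function.comp, hh.eq_self a ha, hg.eq_self a (ha.trans_le (hU.src_mono hij))]
  · have h1 := hh.nodeLevel_apply hU hij ha
    exact hU.mem_liftSeg_of_le hij hjk (hh.mem_lift a ha) (hg.le_apply h1) (hg.mem_lift _ h1)

theorem of_skipsOnlyLevel (U : ℕ → FatEdge τ) (k : ℕ) {F : T → T} (hF : F ∈ τ.M)
    (hs : SkipsOnlyLevel F (U k).src) : IsLiftMap U k (k + 1) ((U k).ext' ∘ F) := by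
  refine ⟨τ.comp_mem _ (U k).ext'_mem _ hF, fun a ha => ?_, fun a ha => ?_⟩
  · rw [Function.comp, SMTree.apply_eq_self_of_skipsOnlyLevel hF hs ha, (U k).ext'_eq_self ha]
  · rw [liftSeg_succ le_rfl, liftSeg_self]
    refine ⟨F a, ⟨a, ha, ?_⟩, rfl⟩
    refine τ.covBy_of_le_nodeLevel ?_ ?_
    · exact (τ.shape_preserving _ hF).le_apply
        (fun b hb => SMTree.apply_eq_self_of_skipsOnlyLevel hF hs hb) ha.le
    · rw [SMTree.nodeLevel_of_skipsOnlyLevel hF hs, if_neg (by omega)]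

theorem truncate (hU : τ.pathSystem.IsInf U) (hij : i ≤ j) (hjk : j ≤ k)
    (hh : IsLiftMap U i k h) : ∃ g, IsLiftMap U i j g ∧ ∀ a, nodeLevel a = (U i).src → g a ≤ h a := by
  obtain ⟨g, hg, h1, h2, h3⟩ := SMTree.exists_decomposition hh.mem hh.eq_self
    (fun a ha => hh.nodeLevel_apply hU (hij.trans hjk) ha) (hU.src_mono hij) (hU.src_mono hjk)
  refine ⟨g, ⟨hg, h1, fun a ha => ?_⟩, h3⟩
  obtain ⟨y, hy, hya⟩ := hU.exists_le_mem_liftSeg hij hjk (hh.mem_lift a ha)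
  rwa [τ.eq_of_le_of_le (h3 a ha) hya (by rw [h2 a ha, hU.nodeLevel_liftSeg hij hy])]

/-- The edge defined by a map along the lifts of `U`. -/
theorem exists_edge (hU : τ.pathSystem.IsInf U) (hik : i ≤ k) (hh : IsLiftMap U i k h) :
    ∃ e ∈ τ.pathSystem.Span U, e.src = (U i).src ∧ e.top = (U k).top ∧
      ∀ a, nodeLevel a = (U i).src → e.ext' a = (U k).ext' (h a) := by
  have hlev := fun a ha => hh.nodeLevel_apply hU hik (a := a) ha
  let e : FatEdge τ := FatEdge.ofFun ((U k).ext' ∘ h) (U i).src (U k).top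
    (τ.comp_mem _ (U k).ext'_mem _ hh.mem)
    (fun a ha => by
      rw [Function.comp, hh.eq_self a ha, (U k).ext'_eq_self (ha.trans_le (hU.src_mono hik))])
    (fun a ha => by
      rw [Function.comp, (U k).nodeLevel_ext' (hlev a ha).ge, hlev a ha, Nat.sub_self, Nat.add_zero])
  have he : ∀ a, nodeLevel a = (U i).src → e.ext' a = (U k).ext' (h a) :=
    fun a ha => FatEdge.ofFun_ext' ha
  refine ⟨e, ⟨i, k + 1, by omega, ?_, ?_⟩, rfl, rfl, he⟩
  · have := hU.isPath_seg (show i ≤ k + 1 by omega)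
    rwa [hU.2] at this
  · rintro _ ⟨b, ⟨a, ha, hab⟩, rfl⟩
    have ha' : nodeLevel a = (U i).src := ha
    obtain ⟨p, x, hp⟩ := τ.succ_constr _ _ hab
    have h1 := e.succOp_ext' ha hp
    rw [he a ha'] at h1
    obtain ⟨d, hd, -⟩ := (τ.shape_preserving _ hh.mem).succOp_le hh.eq_self hp ha'.le
    have h2 := (U k).succOp_ext' (hlev a ha') hd
    rw [h1] at h2
    rw [Option.some.inj h2]
    change _ ∈ liftSeg U i (k + 1)
    rw [liftSeg_succ hik]
    exact ⟨d, ⟨h a, hh.mem_lift a ha', (τ.succ_spec _ _ _ _ hd).1⟩, rfl⟩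

end IsLiftMap

/-- The edge is factored through the last cut level before its target. That the first factor runs
along the lifts is read off from images of successors, since a node determines its predecessor in
the successor operation. -/
theorem exists_isLiftMap_of_mem_span (hU : τ.pathSystem.IsInf U) {i : ℕ} {e : FatEdge τ}
    (he : e ∈ τ.pathSystem.Span U) (hs : e.src = (U i).src) :
    ∃ k h, i ≤ k ∧ IsLiftMap U i k h ∧ e.top = (U k).top ∧
      ∀ a, nodeLevel a = (U i).src → e.ext' a = (U k).ext' (h a) := by
  obtain ⟨i', j, hij, hsp⟩ := he
  obtain rfl : i' = i := hU.strictMono.injective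
    (show (U i').src = (U i).src from (PathSystem.sp.src_eq hsp hij).trans hs)
  have htgt := hU.sp_tgt_eq hsp hij
  obtain ⟨k, rfl⟩ : ∃ k, j = k + 1 := ⟨j - 1, by omega⟩
  rw [hU.2] at htgt
  have htop : e.top = (U k).top := Nat.succ_injective htgt
  have hik : i' ≤ k := by omega
  have hm : ∀ a, nodeLevel a = e.src → nodeLevel (e.ext' a) = e.top := fun a ha => by
    rw [e.nodeLevel_ext' ha.ge, ha, Nat.sub_self, Nat.add_zero]
  obtain ⟨h, hh, h1, h2, h3⟩ := SMTree.exists_decomposition e.ext'_mem (N := (U k).src)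
    (fun a ha => e.ext'_eq_self ha) hm (by rw [hs]; exact hU.src_mono hik)
    (by rw [htop]; exact (U k).src_le_top)
  rw [hs] at h1 h2 h3 hm
  have key : ∀ a, nodeLevel a = (U i').src → h a ∈ liftSeg U i' k ∧ e.ext' a = (U k).ext' (h a) := by
    intro a ha
    have hle := e.le_ext' (ha.trans hs.symm)
    -- A node fixed by the edge may be a leaf and offer no successor to test; in that case source
    -- and top coincide. Otherwise a successor exists below the image.
    rcases eq_or_lt_of_le hle with heq | hlt
    · have h4 : h a = a := τ.eq_of_le_of_le ((h3 a ha).trans heq.symm.le) le_rfl (by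
        have h5 := (τ.shape_preserving _ hh).le_nodeLevel a
        have h6 := τ.nodeLevel_le (h3 a ha)
        rw [← heq] at h6
        exact le_antisymm h6 h5)
      have h5 : (U i').src = (U k).src := by rw [← h2 a ha, h4, ha]
      obtain rfl : i' = k := hU.strictMono.injective h5
      rw [h4, liftSeg_self]
      refine ⟨ha, ?_⟩
      rw [← heq]
      refine τ.eq_of_le_of_le ((U i').le_ext' ha) le_rfl ?_
      rw [(U i').nodeLevel_ext' ha.ge, ← htop, ← hm a ha, ← heq]
      omega
    · obtain ⟨b, hab, -⟩ := τ.exists_covBy_of_lt hlt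
      have h4 : e.ext' b ∈ liftSeg U i' (k + 1) := by
        have := hsp.2 ⟨b, ⟨a, ha.trans hs.symm, hab⟩, rfl⟩
        rwa [hs] at this
      rw [liftSeg_succ hik] at h4
      obtain ⟨b', ⟨y, hy, hyb⟩, hb'⟩ := h4
      have hyl := hU.nodeLevel_liftSeg hik hy
      obtain ⟨p, x, hp⟩ := τ.succ_constr _ _ hab
      obtain ⟨p', x', hp'⟩ := τ.succ_constr _ _ hyb
      have h5 := e.succOp_ext' (ha.trans hs.symm) hp
      have h6 := (U k).succOp_ext' hyl hp'
      rw [hb'] at h6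
      have h7 := (τ.succ_inj _ _ _ _ _ _ _ h5 h6).1
      have h8 : h a = y := τ.eq_of_le_of_le (h3 a ha) (h7 ▸ (U k).le_ext' hyl)
        (by rw [h2 a ha, hyl])
      rw [h8]
      exact ⟨hy, h7⟩
  exact ⟨k, h, hik, ⟨hh, h1, fun a ha => (key a ha).1⟩, htop, fun a ha => (key a ha).2⟩

end CopyingLevels

/-! ### The action of words and rich paths -/

section Pigeonhole

open PathSystem

variable {T A : Type*} [PartialOrder T] {τ : SMTree T A} {U : ℕ → FatEdge τ}

/-- The step from the cut level of index `k` to the next one that copies the successors taken at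
level `ℓ` (at level `0` if `ℓ` is not below the cut level). -/
noncomputable def copyStep (U : ℕ → FatEdge τ) (k ℓ : ℕ) : T → T :=
  (U k).ext' ∘ τ.dup (if ℓ < (U k).src then ℓ else 0) (U k).src

theorem copyStep_of_lt {k ℓ : ℕ} (h : ℓ < (U k).src) (y : T) :
    copyStep U k ℓ y = (U k).ext' (τ.dup ℓ (U k).src y) := by
  rw [copyStep, if_pos h]; rfl

theorem isLiftMap_copyStep {k : ℕ} (h : 0 < (U k).src) (ℓ : ℕ) :
    IsLiftMap U k (k + 1) (copyStep U k ℓ) := by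
  have h1 : (if ℓ < (U k).src then ℓ else 0) < (U k).src := by split_ifs <;> assumption
  exact IsLiftMap.of_skipsOnlyLevel U k (SMTree.dup_mem h1) (SMTree.dup_skips h1)

/-- The composition of the copying steps given by a list of levels. -/
noncomputable def copyWord (U : ℕ → FatEdge τ) : ℕ → List ℕ → T → T
  | _, [] => id
  | k, ℓ :: s => copyWord U (k + 1) s ∘ copyStep U k ℓ

theorem isLiftMap_copyWord (hU : τ.pathSystem.IsInf U) {k : ℕ} (h : 0 < (U k).src) (s : List ℕ) :
    IsLiftMap U k (k + s.length) (copyWord U k s) := by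
  induction s generalizing k with
  | nil => exact IsLiftMap.id U k
  | cons ℓ s ih =>
    have h1 := ih (k := k + 1) (h.trans_le (hU.src_mono (Nat.le_succ k)))
    have h2 := h1.comp hU (Nat.le_succ k) (by omega) (isLiftMap_copyStep h ℓ)
    rwa [List.length_cons, add_comm s.length 1, ← add_assoc]

theorem foldl_copyStep {ι : Type*} (U : ℕ → FatEdge τ) (s : List ℕ) (k : ℕ) (w : ι → T) :
    s.foldl (fun (x : ℕ × (ι → T)) ℓ => (x.1 + 1, copyStep U x.1 ℓ ∘ x.2)) (k, w) =
      (k + s.length, copyWord U k s ∘ w) := by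
  induction s generalizing k w with
  | nil => rfl
  | cons ℓ s ih =>
    rw [List.foldl_cons, ih, List.length_cons, add_comm s.length 1, ← add_assoc]
    rfl

/-- A copy depends only on the parameters and letter found at the copied level, and these remain
visible below all later nodes. -/
theorem copyWord_congr (hU : τ.pathSystem.IsInf U) (z : List (Option ℕ)) {k ℓ ℓ' : ℕ} {y : T}
    (hy : nodeLevel y = (U k).src) (hℓ : ℓ < (U k).src) (hℓ' : ℓ' < (U k).src) {p : List T} {x : A}
    (h : τ.LetterAt y ℓ p x) (h' : τ.LetterAt y ℓ' p x) :
    copyWord U k (z.map fun o => o.getD ℓ) y = copyWord U k (z.map fun o => o.getD ℓ') y := by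
  induction z generalizing k y with
  | nil => rfl
  | cons o z ih =>
    have h0 : 0 < (U k).src := by omega
    have key : copyStep U k (o.getD ℓ) y = copyStep U k (o.getD ℓ') y := by
      cases o with
      | some a => rfl
      | none =>
        rw [Option.getD_none, Option.getD_none, copyStep_of_lt hℓ, copyStep_of_lt hℓ']
        congr 1
        exact Option.some.inj ((SMTree.succOp_dup hℓ hy h).symm.trans (SMTree.succOp_dup hℓ' hy h'))
    have hst := isLiftMap_copyStep h0 (o.getD ℓ')
    have hle := hst.le_apply hy
    have hm : (U k).src ≤ (U (k + 1)).src := hU.src_mono (Nat.le_succ k)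
    simp only [List.map_cons, copyWord, Function.comp]
    rw [key]
    exact ih (hst.nodeLevel_apply hU (Nat.le_succ k) hy) (by omega) (by omega) (h.mono hle)
      (h'.mono hle)

namespace FatEdge

/-- The sets of successors of nodes of the source level that occur along the edge, simultaneously
at a single level. -/
def occurring (e : FatEdge τ) : Set (Set T) :=
  {B | B ⊆ levelSet T (e.src + 1) ∧ ∃ ℓ < e.top, ∀ b ∈ B, ∀ a p x, τ.succOp a p x = some b →
    τ.LetterAt (e.ext' a) ℓ p x}

theorem occurring_subset (e : FatEdge τ) : e.occurring ⊆ 𝒫 (levelSet T (e.src + 1)) :=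
  fun _ hB => hB.1

theorem finite_occurring (e : FatEdge τ) : e.occurring.Finite :=
  (τ.finite_level (e.src + 1)).finite_subsets.subset e.occurring_subset

end FatEdge

/-- The edge of index `k` of `U` has the largest possible number of occurring successor sets. -/
def IsRich (U : ℕ → FatEdge τ) (k : ℕ) : Prop :=
  ∀ e ∈ τ.pathSystem.Span U, e.src = (U k).src → e.occurring.ncard ≤ (U k).occurring.ncard

/-- The image of a node under `e` lies above its image under `U k`, so whatever occurs along `U k`
still occurs along `e`. -/
theorem occurring_subset_of_mem_span (hU : τ.pathSystem.IsInf U) {k : ℕ} {e : FatEdge τ}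
    (he : e ∈ τ.pathSystem.Span U) (hs : e.src = (U k).src) :
    (U k).occurring ⊆ e.occurring := by
  obtain ⟨j, h, hkj, hh, htop, heq⟩ := exists_isLiftMap_of_mem_span hU he hs
  have hle : (U k).top ≤ e.top := by
    have h1 := hU.src_mono (show k + 1 ≤ j + 1 by omega)
    rw [hU.src_succ, hU.src_succ] at h1
    omega
  rintro B ⟨hB, ℓ, hℓ, hBℓ⟩
  refine ⟨by rw [hs]; exact hB, ℓ, by omega, fun b hb a p x hp => (hBℓ b hb a p x hp).mono ?_⟩
  have ha : nodeLevel a = (U k).src := by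
    have h1 := STree.nodeLevel_succOp hp
    have h2 : nodeLevel b = (U k).src + 1 := hB hb
    omega
  rw [heq a ha]
  rcases Nat.eq_or_lt_of_le hkj with rfl | hlt
  · have h1 : h a = a := (τ.eq_of_le_of_le (hh.le_apply ha) le_rfl
      (by rw [hh.nodeLevel_apply hU le_rfl ha, ha])).symm
    rw [h1]
  · have h1 := hU.ext'_le_of_mem_liftSeg hlt ha (hh.le_apply ha) (hh.mem_lift a ha)
    exact h1.trans ((U j).le_ext' (hh.nodeLevel_apply hU hkj ha))

/-- In a rich path, every simultaneous choice of successors that is available to a subtree is a copy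
of the choice at an earlier level. -/
theorem IsRich.exists_copy (hU : τ.pathSystem.IsInf U) {k j : ℕ} (hR : IsRich U k) (hkj : k < j)
    {h : T → T} (hh : IsLiftMap U k j h) {G : T → T} (hG : G ∈ τ.M)
    (hGs : SkipsOnlyLevel G (U j).top) {Y : Set T} (hY : Y ⊆ levelSet T (U k).src)
    (hsucc : ∀ y ∈ Y, ∃ p x b, τ.succOp y p x = some b ∧
      τ.succOp ((U j).ext' (h y)) p x = some (G ((U j).ext' (h y)))) :
    ∃ ℓ < (U k).top, ∀ y ∈ Y, G ((U j).ext' (h y)) = copyStep U j ℓ (h y) := by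
  have hj0 : 0 < (U j).src := by
    have : (U k).src < (U j).src := hU.strictMono hkj
    omega
  have hhl := fun y hy => hh.nodeLevel_apply hU hkj.le (a := y) hy
  set m := (U j).top with hm
  have hjm : (U j).src ≤ m := (U j).src_le_top
  have hm0 : 0 < m := by omega
  have hgl : ∀ y, nodeLevel y = (U k).src → nodeLevel ((U j).ext' (h y)) = m := fun y hy => by
    rw [(U j).nodeLevel_ext' (hhl y hy).ge, hhl y hy, Nat.sub_self, Nat.add_zero]
  have hGid : ∀ a, nodeLevel a < m → G a = a :=
    fun a ha => SMTree.apply_eq_self_of_skipsOnlyLevel hG hGs ha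
  have hGl : ∀ a, nodeLevel a = m → nodeLevel (G a) = m + 1 := fun a ha => by
    rw [SMTree.nodeLevel_of_skipsOnlyLevel hG hGs, if_neg (by omega), ha]
  let X := τ.dup 0 m
  have hX : X ∈ τ.M := SMTree.dup_mem hm0
  have hXs : SkipsOnlyLevel X m := SMTree.dup_skips hm0
  have hXsp := τ.shape_preserving X hX
  have hXid : ∀ a, nodeLevel a < m → X a = a :=
    fun a ha => SMTree.apply_eq_self_of_skipsOnlyLevel hX hXs ha
  have hXl : ∀ a, m ≤ nodeLevel a → nodeLevel (X a) = nodeLevel a + 1 := fun a ha => by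
    rw [SMTree.nodeLevel_of_skipsOnlyLevel hX hXs, if_neg (by omega)]
  -- `G` skips the level just below a cut, so it need not act along the lifts of `U`. Decomposing `X
  -- ∘ G` postpones its choice by one level: on level `m` it becomes first `X`, then a function
  -- skipping exactly the cut level `m + 1`.
  obtain ⟨F₃, hF₃, F₄, hF₄, hF₄s, hcomp, h3l, -⟩ := SMTree.exists_decomposition_top
    (τ.comp_mem _ hX _ hG) (n := m) (m := m + 1)
    (fun a ha => by rw [Function.comp, hXl _ (by rw [hGl a ha]; omega), hGl a ha])
    (fun a ha => by rw [Function.comp, hGid a ha, hXid a ha]; omega)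
  have h3X : ∀ a, nodeLevel a = m → F₃ a = X a := by
    intro a ha
    have h1 : F₃ a ≤ X (G a) := by
      have := hcomp a ha.le
      rw [Function.comp] at this
      rw [← this]
      exact (τ.shape_preserving _ hF₄).le_apply
        (fun b hb => SMTree.apply_eq_self_of_skipsOnlyLevel hF₄ hF₄s hb) (h3l a ha).le
    have h2 : X a ≤ X (G a) := hXsp.mono ((τ.shape_preserving _ hG).le_apply hGid ha.le)
    exact τ.eq_of_le_of_le h1 h2 (by rw [h3l a ha, hXl a ha.ge, ha])
  have hjsrc : (U (j + 1)).src = m + 1 := hU.src_succ j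
  let H : T → T := copyStep U j 0 ∘ h
  have hH : IsLiftMap U k (j + 1) H := (isLiftMap_copyStep hj0 0).comp hU hkj.le (Nat.le_succ j) hh
  have hHX : ∀ y, nodeLevel y = (U k).src → H y = X ((U j).ext' (h y)) := fun y hy => by
    change copyStep U j 0 (h y) = _
    rw [copyStep_of_lt hj0]
    exact (FatEdge.dup_ext' _ hj0 (hhl y hy)).symm
  have hH2 : IsLiftMap U k (j + 2) (((U (j + 1)).ext' ∘ F₄) ∘ H) :=
    (IsLiftMap.of_skipsOnlyLevel U (j + 1) hF₄ (by rw [hjsrc]; exact hF₄s)).comp hU (by omega)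
      (by omega) hH
  obtain ⟨v, hv, hvs, hvt, hve⟩ := hH2.exists_edge hU (by omega)
  -- The successors of nodes of `Y` that encode the choice made by `G`. They occur together along
  -- `v`, at the level `(U (j + 1)).top`.
  let B : Set T := {b | ∃ y ∈ Y, ∃ p x, τ.succOp y p x = some b ∧
      τ.succOp ((U j).ext' (h y)) p x = some (G ((U j).ext' (h y)))}
  have hBv : B ∈ v.occurring := by
    refine ⟨?_, (U (j + 1)).top, ?_, ?_⟩
    · rintro b ⟨y, hy, p, x, hp, -⟩
      have h1 : nodeLevel y = (U k).src := hY hy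
      change nodeLevel b = v.src + 1
      rw [STree.nodeLevel_succOp hp, hvs, h1]
    · have h1 := hU.src_succ (j + 1)
      have h2 := (U (j + 1 + 1)).src_le_top
      rw [hvt]
      change (U (j + 1)).top < (U (j + 1 + 1)).top
      omega
    · rintro b ⟨y, hy, p', x', hp', hGp⟩ a p x hp
      obtain ⟨rfl, rfl, rfl⟩ := τ.succ_inj _ _ _ _ _ _ _ hp hp'
      have ha : nodeLevel a = (U k).src := hY hy
      have hHl : nodeLevel (H a) = (U (j + 1)).src := hH.nodeLevel_apply hU (by omega) ha
      have h1 : τ.succOp (H a) p x = some (F₄ (H a)) := by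
        rw [hHX a ha, ← h3X _ (hgl a ha), hcomp _ (hgl a ha).le, h3X _ (hgl a ha)]
        exact hXsp.succOp_apply hXid hGp (hgl a ha).le
          (by rw [hXl _ (by rw [hGl _ (hgl a ha)]; omega), hGl _ (hgl a ha), hXl _ (hgl a ha).ge,
            hgl a ha])
      have h2 := (U (j + 1)).succOp_ext' hHl h1
      refine ⟨_, _, ?_, h2, ?_⟩
      · rw [(U (j + 1)).nodeLevel_ext' hHl.ge, hHl, Nat.sub_self, Nat.add_zero]
      · rw [hve a ha]
        exact (U (j + 2)).le_ext' (hH2.nodeLevel_apply hU (by omega) ha)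
  -- By richness the edge `U k` exhibits the same choice, at some level below its top.
  have hEq : (U k).occurring = v.occurring :=
    Set.eq_of_subset_of_ncard_le (occurring_subset_of_mem_span hU hv hvs) (hR v hv hvs)
      v.finite_occurring
  rw [← hEq] at hBv
  obtain ⟨-, ℓ, hℓ, hBℓ⟩ := hBv
  refine ⟨ℓ, hℓ, fun y hy => ?_⟩
  obtain ⟨p, x, b, hb, hGb⟩ := hsucc y hy
  have hyl : nodeLevel y = (U k).src := hY hy
  have h1 := hBℓ b ⟨y, hy, p, x, hb, hGb⟩ y p x hb
  have h2 := hU.ext'_le_of_mem_liftSeg hkj hyl (hh.le_apply hyl) (hh.mem_lift y hyl)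
  have hℓj : ℓ < (U j).src := by
    have h3 := hU.src_mono (show k + 1 ≤ j from hkj)
    rw [hU.src_succ] at h3
    omega
  have h4 := (U j).succOp_ext' (hhl y hyl) (SMTree.succOp_dup hℓj (hhl y hyl) (h1.mono h2))
  rw [copyStep_of_lt hℓj]
  exact Option.some.inj (hGb.symm.trans h4)

theorem near_of_tail {E : Type*} {P : PathSystem E} {U W : ℕ → E} (hU : P.IsInf U) {n : ℕ}
    (h0 : P.src (W 0) = P.src (U n)) (hW : ∀ i, P.src (W (i + 1)) = P.tgt (W i))
    (hs : ∀ i, W i ∈ P.Span U) : P.Near n U fun i => if i < n then U i else W (i - n) := by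
  refine ⟨⟨?_, fun i => ?_⟩, fun i => ?_, fun i hi => if_pos hi⟩
  · simp only
    split_ifs with h
    · exact hU.1
    · obtain rfl : n = 0 := by omega
      rw [h0, hU.1]
  · simp only
    by_cases h1 : i + 1 < n
    · rw [if_pos h1, if_pos (by omega), hU.2]
    · by_cases h2 : i < n
      · obtain rfl : n = i + 1 := by omega
        rw [if_neg h1, if_pos h2, Nat.sub_self, h0, hU.2]
      · rw [if_neg h1, if_neg h2, ← hW, Nat.sub_add_comm (by omega)]
  · simp only
    split_ifs
    · exact IsInf.mem_span i
    · exact hs _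

/-- The number of occurring sets is bounded at each cut level, so an edge with the maximum can be
chosen at each cut point reached. Maximality survives because the span only shrinks. -/
theorem exists_near_isRich (hU : τ.pathSystem.IsInf U) (n : ℕ) :
    ∃ V, τ.pathSystem.Near n U V ∧ ∀ i ≥ n, IsRich V i := by
  have hmax : ∀ k, ∃ e ∈ τ.pathSystem.Span U, e.src = (U k).src ∧
      (∀ e' ∈ τ.pathSystem.Span U, e'.src = (U k).src →
        e'.occurring.ncard ≤ e.occurring.ncard) ∧ ∃ k', e.tgt = (U k').src := by
    intro k
    let S : Set ℕ := (fun e : FatEdge τ => e.occurring.ncard) ''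
      {e | e ∈ τ.pathSystem.Span U ∧ e.src = (U k).src}
    have hne : S.Nonempty := ⟨_, U k, ⟨IsInf.mem_span k, rfl⟩, rfl⟩
    have hbdd : BddAbove S := by
      refine ⟨(𝒫 (levelSet T ((U k).src + 1))).ncard, ?_⟩
      rintro _ ⟨e, ⟨-, he⟩, rfl⟩
      rw [← he]
      exact Set.ncard_le_ncard e.occurring_subset (τ.finite_level _).finite_subsets
    obtain ⟨e, ⟨he, hes⟩, hee⟩ := Nat.sSup_mem hne hbdd
    refine ⟨e, he, hes, fun e' he' hes' => ?_, ?_⟩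
    · simp only at hee
      rw [hee]
      exact le_csSup hbdd ⟨e', ⟨he', hes'⟩, rfl⟩
    · obtain ⟨i, j, hij, hsp⟩ := he
      exact ⟨j, hU.sp_tgt_eq hsp hij⟩
  choose e heU hes hemax κ hκ using hmax
  let K : ℕ → ℕ := fun i => Nat.rec n (fun _ k => κ k) i
  have hN := near_of_tail (W := fun i => e (K i)) hU (n := n) (hes n)
    (fun i => (hes (κ (K i))).trans (hκ (K i)).symm) fun i => heU _
  refine ⟨_, hN, fun i hi e' he' hes' => ?_⟩
  have h1 := hU.span_subset hN.1 hN.2.1 he'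
  simp only [if_neg (not_lt.2 hi)] at hes' ⊢
  exact hemax _ e' h1 (hes'.trans (hes _))

end Pigeonhole

/-! ### Homogeneous subtrees -/

section Pigeonhole

open PathSystem

variable {T A : Type*} [PartialOrder T] {τ : SMTree T A} {U : ℕ → FatEdge τ}

/-- A stage in the construction of a homogeneous subtree: the cut level of index `k` has been
reached, `W` contains the maps from the cut level of index `n` along the part built so far, and `lift`
is the beginning of the next edge. -/
structure HomogeneousStage (U : ℕ → FatEdge τ) (n : ℕ)
    (G : Set (ℕ × ({a : T // nodeLevel a = (U n).src} → T))) where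
  k : ℕ
  k' : ℕ
  lift : T → T
  W : Set ({a : T // nodeLevel a = (U n).src} → T)
  le_k : n ≤ k
  k_le : k ≤ k'
  pos : 0 < (U k').src
  isLiftMap : IsLiftMap U k k' lift
  finite : W.Finite
  nodeLevel_eq : ∀ w ∈ W, ∀ a, nodeLevel (w a) = (U k).src
  mem : ∀ w ∈ W, (k', lift ∘ w) ∈ G

/-- The recurrence is applied with the levels below `(U s.k).top` as letters. The word `t` completes
the map of the present edge, the letter is the choice made after that edge, and `z` becomes the
beginning of the following edge. -/
theorem HomogeneousStage.exists_next (hU : τ.pathSystem.IsInf U) {n : ℕ}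
    {G E : Set (ℕ × ({a : T // nodeLevel a = (U n).src} → T))}
    (hG : ∀ W : Set (ℕ × ({a : T // nodeLevel a = (U n).src} → T)), W.Finite → W ⊆ G →
      ∀ S : Finset ℕ, ∃ (t : List ℕ) (z : List (Option ℕ)), t ≠ [] ∧ ∀ w ∈ W,
        t.foldl (fun x ℓ => (x.1 + 1, copyStep U x.1 ℓ ∘ x.2)) w ∈ E ∧
          ∀ f ∈ S, (t ++ f :: z.map fun o => o.getD f).foldl
            (fun x ℓ => (x.1 + 1, copyStep U x.1 ℓ ∘ x.2)) w ∈ G)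
    (s : HomogeneousStage U n G) :
    ∃ (s' : HomogeneousStage U n G) (j : ℕ) (B : T → T), s.k < j ∧ IsLiftMap U s.k j B ∧
      s'.k = j + 1 ∧ (∀ w ∈ s.W, (j, B ∘ w) ∈ E) ∧
        ∀ w ∈ s.W, ∀ ℓ < (U s.k).top, copyStep U j ℓ ∘ B ∘ w ∈ s'.W := by
  obtain ⟨t, z, ht, h⟩ := hG ((fun w => (s.k', s.lift ∘ w)) '' s.W) (s.finite.image _)
    (by rintro _ ⟨w, hw, rfl⟩; exact s.mem w hw) (Finset.range (U s.k).top)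
  have htl : 0 < t.length := List.length_pos_iff.2 ht
  have hkk := s.k_le
  let j := s.k' + t.length
  let B := copyWord U s.k' t ∘ s.lift
  have hkj : s.k < j := by omega
  have hB : IsLiftMap U s.k j B :=
    (isLiftMap_copyWord hU s.pos t).comp hU s.k_le (by omega) s.isLiftMap
  have hj0 : 0 < (U j).src := s.pos.trans_le (hU.src_mono (by omega))
  have hj1 : 0 < (U (j + 1)).src := s.pos.trans_le (hU.src_mono (by omega))
  have htop : (U s.k).top < (U j).src := by
    have h3 := hU.src_mono (show s.k + 1 ≤ j from hkj)
    rw [hU.src_succ] at h3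
    omega
  let W' : Set ({a : T // nodeLevel a = (U n).src} → T) :=
    (fun x : ({a : T // nodeLevel a = (U n).src} → T) × ℕ => copyStep U j x.2 ∘ B ∘ x.1) ''
      (s.W ×ˢ Set.Iio (U s.k).top)
  have hBw : ∀ w ∈ s.W, ∀ a, nodeLevel (B (w a)) = (U j).src := fun w hw a =>
    hB.nodeLevel_apply hU hkj.le (s.nodeLevel_eq w hw a)
  let s' : HomogeneousStage U n G :=
    { k := j + 1
      k' := j + 1 + (z.map fun o => o.getD (U j).top).length
      -- The letter is not known yet when this map is fixed. Level `(U j).top` carries a copy of the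
      -- chosen level `ℓ`, so this substitution acts like that of `ℓ`, for all `ℓ` at once.
      lift := copyWord U (j + 1) (z.map fun o => o.getD (U j).top)
      W := W'
      le_k := by have := s.le_k; omega
      k_le := by omega
      pos := s.pos.trans_le (hU.src_mono (by omega))
      isLiftMap := isLiftMap_copyWord hU hj1 _
      finite := (s.finite.prod (Set.finite_Iio _)).image _
      nodeLevel_eq := by
        rintro _ ⟨⟨w, ℓ⟩, ⟨hw, hℓ⟩, rfl⟩ a
        exact (isLiftMap_copyStep hj0 ℓ).nodeLevel_apply hU (Nat.le_succ j) (hBw w hw a)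
      mem := by
        rintro _ ⟨⟨w, ℓ⟩, ⟨hw, hℓ⟩, rfl⟩
        have h1 := (h _ ⟨w, hw, rfl⟩).2 ℓ (Finset.mem_range.2 hℓ)
        dsimp only at h1
        rw [List.foldl_append, foldl_copyStep U t s.k' (s.lift ∘ w), List.foldl_cons,
          foldl_copyStep] at h1
        have hℓj : ℓ < (U j).src := lt_trans hℓ htop
        convert h1 using 2
        · simp; rfl
        · funext a
          have hx := hBw w hw a
          obtain ⟨p, x, hp⟩ := τ.exists_letterAt (y := B (w a)) (ℓ := ℓ) (by omega)
          have h2 := (U j).succOp_ext' hx (SMTree.succOp_dup hℓj hx hp)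
          rw [← copyStep_of_lt hℓj] at h2
          have h3 := (τ.succ_spec _ _ _ _ h2).1.le
          have h4 : nodeLevel ((U j).ext' (B (w a))) = (U j).top := by
            rw [(U j).nodeLevel_ext' hx.ge, hx, Nat.sub_self, Nat.add_zero]
          have hjs := hU.src_succ j
          have h5 := (U j).src_le_top
          exact (copyWord_congr hU z
            ((isLiftMap_copyStep hj0 ℓ).nodeLevel_apply hU (Nat.le_succ j) hx) (by omega) (by omega)
            (hp.mono (((U j).le_ext' hx).trans h3)) ⟨_, _, h4, h2, le_rfl⟩).symm }
  refine ⟨s', j, B, hkj, hB, rfl, fun w hw => ?_, fun w hw ℓ hℓ => ⟨(w, ℓ), ⟨hw, hℓ⟩, rfl⟩⟩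
  have h1 := (h _ ⟨w, hw, rfl⟩).1
  rwa [foldl_copyStep] at h1

/-- The stages yield the edges of `V`. Every map along the lifts of `V` from index `n` belongs to
the finite set of its stage, so all spanned edges from that cut level receive the colour `E'`. -/
theorem exists_homogeneous_of_isRich (hU : τ.pathSystem.IsInf U) {n : ℕ}
    (hR : ∀ i ≥ n, IsRich U i) (O : Set (FatEdge τ)) : ∃ V, τ.pathSystem.Near n U V ∧
      ((∀ e ∈ τ.pathSystem.Span V, e.src = (U n).src → e ∈ O) ∨
        ∀ e ∈ τ.pathSystem.Span V, e.src = (U n).src → e ∉ O) := by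
  by_cases hne : ∃ h, IsLiftMap U n (n + 1) h
  swap
  -- Without a lift map to the next cut level, `U n` is the only spanned edge with this source.
  -- Duplication excludes this case at positive levels only.
  · have huniq : ∀ e ∈ τ.pathSystem.Span U, e.src = (U n).src → e = U n := by
      intro e he hs
      obtain ⟨k, h, hnk, hh, -, heq⟩ := exists_isLiftMap_of_mem_span hU he hs
      rcases Nat.eq_or_lt_of_le hnk with rfl | hlt
      · refine FatEdge.eq_of_ext' hs fun a ha => ?_
        have ha' := ha.trans hs
        rw [heq a ha', ← τ.eq_of_le_of_le (hh.le_apply ha') le_rfl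
          (by rw [hh.nodeLevel_apply hU le_rfl ha', ha'])]
      · obtain ⟨g, hg, -⟩ := hh.truncate hU (Nat.le_succ n) hlt
        exact absurd ⟨g, hg⟩ hne
    refine ⟨U, Near.refl hU n, ?_⟩
    by_cases hO : U n ∈ O
    · exact Or.inl fun e he hs => by rw [huniq e he hs]; exact hO
    · exact Or.inr fun e he hs => by rw [huniq e he hs]; exact hO
  obtain ⟨h₀, hh₀⟩ := hne
  have hn1 : 0 < (U (n + 1)).src := by rw [hU.src_succ]; omega
  -- A pair `(k, w)` is coloured by whether the edge `(U k).ext' ∘ w` belongs to `O`.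
  let E : Set (ℕ × ({a : T // nodeLevel a = (U n).src} → T)) :=
    {x | ∃ e ∈ O, e.src = (U n).src ∧ ∀ a, e.ext' a.1 = (U x.1).ext' (x.2 a)}
  obtain ⟨G, E', hE', h0G, hG⟩ := exists_recurrent_coloring
    (fun (x : ℕ × ({a : T // nodeLevel a = (U n).src} → T)) ℓ => (x.1 + 1, copyStep U x.1 ℓ ∘ x.2))
    -- The word action starts one index later, where the cut level is positive and there is
    -- something to copy.
    E (n + 1, fun a => h₀ a.1)
  let s₀ : HomogeneousStage U n G :=
    { k := n
      k' := n + 1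
      lift := h₀
      W := {fun a => a.1}
      le_k := le_rfl
      k_le := Nat.le_succ n
      pos := hn1
      isLiftMap := hh₀
      finite := Set.finite_singleton _
      nodeLevel_eq := by rintro _ rfl a; exact a.2
      mem := by rintro _ rfl; exact h0G }
  choose next J B hkJ hB hnext hBE hBW using fun s => HomogeneousStage.exists_next hU hG s
  let S : ℕ → HomogeneousStage U n G := fun i => Nat.rec s₀ (fun _ s => next s) i
  choose e heU hes het hee using fun i => (hB (S i)).exists_edge hU (hkJ (S i)).le
  have hN := near_of_tail (W := e) hU (n := n) (hes 0) (fun i => by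
    refine (hes (i + 1)).trans ?_
    change (U (next (S i)).k).src = (e i).top + 1
    rw [hnext, hU.src_succ, het]) heU
  set V : ℕ → FatEdge τ := fun i => if i < n then U i else e (i - n) with hVdef
  have hV : ∀ i, V (n + i) = e i := fun i => by
    simp only [hVdef]
    rw [if_neg (by omega), Nat.add_sub_cancel_left]
  have hVn : (V n).src = (U n).src := by rw [← Nat.add_zero n, hV]; exact hes 0
  have key : ∀ i h, IsLiftMap V n (n + i) h →
      (fun a : {a : T // nodeLevel a = (U n).src} => h a.1) ∈ (S i).W := by
    intro i
    induction i with
    | zero =>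
      intro h hh
      change _ = _
      funext a
      have ha : nodeLevel a.1 = (V n).src := by rw [hVn]; exact a.2
      exact (τ.eq_of_le_of_le (hh.le_apply ha) le_rfl
        (by rw [hh.nodeLevel_apply hN.1 le_rfl ha, ha]; rfl)).symm
    | succ i ih =>
      intro h hh
      have hhl : ∀ a, nodeLevel a = (V n).src → nodeLevel (h a) = (e i).top + 1 := fun a ha => by
        rw [hh.nodeLevel_apply hN.1 (by omega) ha, ← hV i]
        exact hN.1.src_succ (n + i)
      have hsrc := hN.1.src_mono (show n ≤ n + i by omega)
      rw [hV] at hsrc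
      have htop := (e i).src_le_top
      -- Splitting off level `(e i).top` isolates the last choice of successors made by `h`: `F₂`
      -- carries `(e i).ext' (g a)` to `h a`.
      obtain ⟨F₁, hF₁, F₂, hF₂, hF₂s, hcomp, h1l, h1e⟩ := SMTree.exists_decomposition_top hh.mem hhl
        fun a ha => by rw [hh.eq_self a ha]; omega
      obtain ⟨g, hg, hgle⟩ := hh.truncate hN.1 (show n ≤ n + i by omega) (by omega)
      have hgW := ih g hg
      have hstep : ∀ a, nodeLevel a = (V n).src → ∃ p x b, τ.succOp (g a) p x = some b ∧
          τ.succOp ((e i).ext' (g a)) p x = some (h a) ∧ F₂ ((e i).ext' (g a)) = h a := by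
        intro a ha
        have h1 := hh.mem_lift a ha
        rw [← add_assoc, liftSeg_succ (by omega), hV] at h1
        obtain ⟨b, ⟨y, hy, hyb⟩, hb⟩ := h1
        have hyl := hN.1.nodeLevel_liftSeg (by omega) hy
        have hgl := hg.nodeLevel_apply hN.1 (by omega) ha
        rw [hV] at hyl hgl
        have h2 := (e i).sp_ext'.mono hyb.le
        rw [hb] at h2
        have h3 : g a = y := τ.eq_of_le_of_le (hgle a ha) (((e i).le_ext' hyl).trans h2)
          (by rw [hgl, hyl])
        subst h3
        obtain ⟨p, x, hp⟩ := τ.succ_constr _ _ hyb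
        have h4 := (e i).succOp_ext' hyl hp
        rw [hb] at h4
        refine ⟨p, x, b, hp, h4, ?_⟩
        have h5 : F₁ a ≤ h a := by
          rw [← hcomp a ha.le]
          exact (τ.shape_preserving _ hF₂).le_apply
            (fun b hb => SMTree.apply_eq_self_of_skipsOnlyLevel hF₂ hF₂s hb) (h1l a ha).le
        rw [← hcomp a ha.le]
        congr 1
        refine (τ.eq_of_le_of_le h5 h2 ?_).symm
        rw [h1l a ha, (e i).nodeLevel_ext' hyl.ge, hyl, Nat.sub_self, Nat.add_zero]
      have hgS : ∀ a, nodeLevel a = (V n).src → nodeLevel (g a) = (U (S i).k).src := fun a ha => by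
        rw [hg.nodeLevel_apply hN.1 (by omega) ha, hV, hes]
      obtain ⟨ℓ, hℓ, hcopy⟩ := (hR _ (S i).le_k).exists_copy hU (hkJ (S i)) (hB (S i)) hF₂
        (by rw [← het]; exact hF₂s) (Y := g '' levelSet T (V n).src)
        (by rintro _ ⟨a, ha, rfl⟩; exact hgS a ha)
        (by
          rintro _ ⟨a, ha, rfl⟩
          obtain ⟨p, x, b, hp, h1, h2⟩ := hstep a ha
          refine ⟨p, x, b, hp, ?_⟩
          rw [← hee i _ (hgS a ha), h1, h2])
      have h6 := hBW (S i) _ hgW ℓ hℓ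
      have h7 : (fun a : {a : T // nodeLevel a = (U n).src} => h a.1) =
          copyStep U (J (S i)) ℓ ∘ B (S i) ∘ fun a => g a.1 := by
        funext a
        have ha : nodeLevel a.1 = (V n).src := by rw [hVn]; exact a.2
        have h8 := hcopy _ ⟨a.1, ha, rfl⟩
        rw [← hee i _ (hgS a.1 ha)] at h8
        obtain ⟨-, -, -, -, -, h9⟩ := hstep a.1 ha
        rw [h9] at h8
        exact h8
      rw [h7]
      exact h6
  have hcol : ∀ e' ∈ τ.pathSystem.Span V, e'.src = (U n).src → ∃ x ∈ E',
      ∀ a : {a : T // nodeLevel a = (U n).src}, e'.ext' a.1 = (U x.1).ext' (x.2 a) := by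
    intro e' he' hs'
    obtain ⟨k, h, hnk, hh, -, heq⟩ := exists_isLiftMap_of_mem_span hN.1 he' (hs'.trans hVn.symm)
    obtain ⟨i, rfl⟩ := Nat.exists_eq_add_of_le hnk
    refine ⟨_, hBE (S i) _ (key i h hh), fun a => ?_⟩
    have ha : nodeLevel a.1 = (V n).src := by rw [hVn]; exact a.2
    rw [heq a.1 ha, hV]
    refine hee i _ ?_
    rw [hh.nodeLevel_apply hN.1 hnk ha, hV, hes]
  refine ⟨V, hN, ?_⟩
  rcases hE' with rfl | rfl
  · left
    intro e' he' hs'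
    obtain ⟨x, ⟨d, hd, hds, hdx⟩, hx⟩ := hcol e' he' hs'
    have : e' = d := FatEdge.eq_of_ext' (hs'.trans hds.symm) fun a ha => by
      rw [hx ⟨a, ha.trans hs'⟩, hdx ⟨a, ha.trans hs'⟩]
    rwa [this]
  · right
    intro e' he' hs' hO
    obtain ⟨x, hxE, hx⟩ := hcol e' he' hs'
    exact hxE ⟨e', hO, hs', hx⟩

theorem SMTree.pigeonhole (τ : SMTree T A) : τ.pathSystem.Pigeonhole := by
  intro U hU n O
  obtain ⟨V, hV, hR⟩ := exists_near_isRich hU n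
  obtain ⟨W, hW, h⟩ := exists_homogeneous_of_isRich hV.1 hR O
  have hs : (V n).src = (U n).src := hV.src_eq hU le_rfl
  rw [hs] at h
  exact ⟨W, hV.trans hU hW le_rfl, h⟩

end Pigeonhole

/-! ### Translation back to fat subtrees -/

section Ellentuck

open PathSystem

namespace SMTree.FatSubtree

variable {T A : Type*} [PartialOrder T] {τ : SMTree T A}

theorem isCut_cut {n : ℕ∞} (U : τ.FatSubtree n) : τ.IsCut n U.seq U.cut := U.exists_cut.choose_spec

/-- The path of edges of an infinite fat subtree. -/
noncomputable def toPath (U : τ.FatSubtree ⊤) (i : ℕ) : FatEdge τ where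
  src := U.cut i
  top := U.cut (i + 1) - 1
  val := U.seq i
  mem := by
    obtain ⟨m, hm, h⟩ := U.isCut_cut.2 i (ENat.natCast_lt_top i)
    rwa [hm, Nat.add_sub_cancel]

theorem toPath_src (U : τ.FatSubtree ⊤) (i : ℕ) : (toPath U i).src = U.cut i := rfl

theorem toPath_tgt (U : τ.FatSubtree ⊤) (i : ℕ) : (toPath U i).tgt = U.cut (i + 1) := by
  obtain ⟨m, hm, h⟩ := U.isCut_cut.2 i (ENat.natCast_lt_top i)
  change U.cut (i + 1) - 1 + 1 = _
  omega

theorem toPath_isInf (U : τ.FatSubtree ⊤) : τ.pathSystem.IsInf (toPath U) :=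
  ⟨U.isCut_cut.1, fun i => (toPath_tgt U i).symm⟩

theorem toPath_injective : Function.Injective (toPath (τ := τ)) := by
  intro U V h
  apply FatSubtree.ext
  funext i
  exact congrArg FatEdge.val (congrFun h i)

theorem exists_toPath_eq {W : ℕ → FatEdge τ} (hW : τ.pathSystem.IsInf W) :
    ∃ U : τ.FatSubtree ⊤, toPath U = W := by
  have hc : τ.IsCut ⊤ (fun i => (W i).val) fun i => (W i).src :=
    ⟨hW.1, fun i _ => ⟨(W i).top, hW.src_succ i, (W i).mem⟩⟩
  let U : τ.FatSubtree ⊤ :=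
    { seq := fun i => (W i).val
      seq_padding := fun i hi => absurd hi (not_le.2 (ENat.natCast_lt_top i))
      exists_cut := ⟨_, hc⟩ }
  have hU : ∀ i, U.cut i = (W i).src := fun i => U.isCut_cut.unique hc i le_top
  refine ⟨U, funext fun i => FatEdge.ext (hU i) ?_ rfl⟩
  change U.cut (i + 1) - 1 = _
  rw [hU, hW.src_succ, Nat.add_sub_cancel]

theorem liftSteps_eq (U : τ.FatSubtree ⊤) (j ℓ : ℕ) (X : Set T) :
    U.liftSteps j ℓ X = FatEdge.liftList (seg (toPath U) ℓ (ℓ + j)) X := by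
  induction j generalizing ℓ X with
  | zero => rw [Nat.add_zero, seg_self]; rfl
  | succ j ih =>
    rw [seg_succ_left _ (by omega), FatEdge.liftList_cons, liftSteps, ih, add_right_comm, add_assoc]
    rfl

theorem lift_eq (U : τ.FatSubtree ⊤) {ℓ k : ℕ} (h : ℓ ≤ k) : U.lift ℓ k = liftSeg (toPath U) ℓ k := by
  rw [lift, liftSteps_eq, Nat.add_sub_cancel' h]
  rfl

theorem lift_succ_eq {n : ℕ∞} (U : τ.FatSubtree n) (ℓ : ℕ) : U.lift ℓ (ℓ + 1) =
    τ.canonicalExtension (U.seq ℓ) (U.cut ℓ) '' succSet (levelSet T (U.cut ℓ)) := by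
  rw [lift, Nat.add_sub_cancel_left]
  rfl

theorem isSubtree_iff {U V : τ.FatSubtree ⊤} :
    V.IsSubtree U ↔ ∀ i, toPath V i ∈ τ.pathSystem.Span (toPath U) := by
  constructor
  · rintro ⟨φ, -, h⟩ i
    obtain ⟨h1, h2, h3⟩ := h i (ENat.natCast_lt_top i)
    obtain ⟨h4, -, -⟩ := h (i + 1) (ENat.natCast_lt_top (i + 1))
    have h5 := (toPath V i).src_lt_tgt
    rw [toPath_tgt, toPath_src, h1, h4] at h5
    -- The definition gives only a weak inequality; it is strict because cut functions increase
    -- strictly.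
    have hlt : φ i < φ (i + 1) := (toPath_isInf U).strictMono.lt_iff_lt.1 h5
    refine ⟨φ i, φ (i + 1), hlt, ?_, ?_⟩
    · have := (toPath_isInf U).isPath_seg h2
      change FatEdge.IsPath (U.cut (φ i)) _ (U.cut (φ (i + 1))) at this
      rw [← h1, ← h4, ← toPath_tgt] at this
      exact this
    · rw [lift_succ_eq, lift_eq U h2, liftSeg, toPath_src, ← h1] at h3
      exact h3
  · intro h
    choose φ ψ hlt hsp using h
    have hs : ∀ i, U.cut (φ i) = V.cut i := fun i => PathSystem.sp.src_eq (hsp i) (hlt i)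
    have hψ : ∀ i, ψ i = φ (i + 1) := fun i => (toPath_isInf U).strictMono.injective
      (show U.cut (ψ i) = U.cut (φ (i + 1)) by
        rw [hs, ← toPath_tgt]
        exact ((toPath_isInf U).sp_tgt_eq (hsp i) (hlt i)).symm)
    refine ⟨φ, fun _ _ => le_top, fun i _ => ⟨(hs i).symm, ?_, ?_⟩⟩
    · rw [← hψ]; exact (hlt i).le
    · rw [← hψ, lift_succ_eq, lift_eq U (hlt i).le, liftSeg, toPath_src, hs]
      exact (hsp i).2

theorem IsSubtree.trans {U V W : τ.FatSubtree ⊤} (h : W.IsSubtree V) (h' : V.IsSubtree U) :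
    W.IsSubtree U :=
  isSubtree_iff.2 fun i => (toPath_isInf U).span_subset (toPath_isInf V) (isSubtree_iff.1 h')
    (isSubtree_iff.1 h i)

theorem cut_eq_of_seq_eq {k : ℕ} {x : τ.FatSubtree k} {B : τ.FatSubtree ⊤}
    (h : ∀ i < k, B.seq i = x.seq i) {i : ℕ} (hi : i ≤ k) : B.cut i = x.cut i := by
  have hc : τ.IsCut k x.seq B.cut := by
    refine ⟨B.isCut_cut.1, fun i hi => ?_⟩
    rw [← h i (by exact_mod_cast hi)]
    exact B.isCut_cut.2 i (ENat.natCast_lt_top i)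
  exact hc.unique x.isCut_cut i (by exact_mod_cast hi)

/-- The finite fat subtree `x` is represented by an initial segment of an infinite one. Equality of
the sequences forces equality of the cut points, hence of the edges. -/
theorem mem_basic_iff {k : ℕ} {x : τ.FatSubtree k} {C : τ.FatSubtree ⊤}
    (hC : ∀ i < k, C.seq i = x.seq i) {B V : τ.FatSubtree ⊤} :
    B ∈ basic x V ↔ toPath B ∈ τ.pathSystem.cyl (seg (toPath C) 0 k) (toPath V) := by
  have hlen : (seg (toPath C) 0 k).length = k := by simp [seg]
  have key : (∀ i < k, B.seq i = x.seq i) ↔ seg (toPath B) 0 k = seg (toPath C) 0 k := by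
    constructor
    · intro h
      refine seg_congr rfl fun i hi => ?_
      rw [Nat.zero_add]
      have hi' : i < k := by omega
      refine FatEdge.ext ?_ ?_ ?_
      · exact (cut_eq_of_seq_eq h hi'.le).trans (cut_eq_of_seq_eq hC hi'.le).symm
      · exact congrArg (· - 1)
          ((cut_eq_of_seq_eq h (i := i + 1) hi').trans (cut_eq_of_seq_eq hC (i := i + 1) hi').symm)
      · exact (h i hi').trans (hC i hi').symm
    · intro h i hi
      rw [← hC i hi]
      have h1 : (seg (toPath B) 0 k)[i]? = (seg (toPath C) 0 k)[i]? := by rw [h]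
      simp only [seg, Nat.sub_zero, List.getElem?_map, List.getElem?_range', hi,
        Option.map_some, Option.some.injEq] at h1
      have h2 : (toPath B i).val = (toPath C i).val := by simpa using congrArg FatEdge.val h1
      exact h2
  constructor
  · rintro ⟨h1, h2⟩
    exact ⟨toPath_isInf B, isSubtree_iff.1 h1, by rw [hlen]; exact key.1 h2⟩
  · rintro ⟨-, h1, h2⟩
    rw [hlen] at h2
    exact ⟨isSubtree_iff.2 h1, key.2 h2⟩

theorem truncate_seq (U : τ.FatSubtree ⊤) {k : ℕ} : ∀ i < k, U.seq i = (U.truncate k).seq i :=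
  fun _ hi => (if_pos hi).symm

/-- Nonempty basic sets correspond to cylinders of the path system. -/
theorem exists_cyl_of_basic_nonempty {k : ℕ} {x : τ.FatSubtree k} {U : τ.FatSubtree ⊤}
    (h : (basic x U).Nonempty) : ∃ (d : ℕ) (y : List (FatEdge τ)), depth U x = d ∧
      τ.pathSystem.IsPath 0 y (τ.pathSystem.src (toPath U d)) ∧
      (∀ e ∈ y, e ∈ τ.pathSystem.Span (toPath U)) ∧
      (∀ B V, B ∈ basic x V ↔ toPath B ∈ τ.pathSystem.cyl y (toPath V)) ∧
      ∀ V, τ.pathSystem.Near d (toPath U) (toPath V) → V ∈ basic (U.truncate d) U := by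
  obtain ⟨C, hCU, hC⟩ := h
  obtain ⟨d, j, hdj, hsp⟩ := isSubtree_iff.1 hCU k
  have hd : U.cut d = C.cut k := PathSystem.sp.src_eq hsp hdj
  have hxk : C.cut k = x.cut k := cut_eq_of_seq_eq hC le_rfl
  have hxU : x.IsSubtree U := by
    obtain ⟨φ, -, h⟩ := hCU
    refine ⟨φ, fun _ _ => le_top, fun ℓ hℓ => ?_⟩
    have hℓ' : ℓ < k := by exact_mod_cast hℓ
    obtain ⟨h1, h2, h3⟩ := h ℓ (ENat.natCast_lt_top ℓ)
    rw [lift_succ_eq, hC ℓ hℓ', cut_eq_of_seq_eq hC hℓ'.le, ← lift_succ_eq] at h3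
    exact ⟨by rw [← h1, cut_eq_of_seq_eq hC hℓ'.le], h2, h3⟩
  refine ⟨d, seg (toPath C) 0 k, ?_, ?_, ?_, fun B V => mem_basic_iff hC, fun V hV => ?_⟩
  · have : {d : ℕ∞ | x.IsSubtree U ∧ ∃ n : ℕ, d = n ∧ U.cut n = x.cut k} = {(d : ℕ∞)} := by
      ext d'
      constructor
      · rintro ⟨-, n, rfl, hn⟩
        have : n = d := (toPath_isInf U).strictMono.injective
          (show U.cut n = U.cut d by rw [hn, hd, hxk])
        rw [this]; rfl
      · rintro rfl
        exact ⟨hxU, d, rfl, hd.trans hxk⟩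
    rw [depth, this, sInf_singleton]
  · have := (toPath_isInf C).isPath_seg (Nat.zero_le k)
    rw [(toPath_isInf C).1] at this
    change τ.pathSystem.IsPath 0 _ (U.cut d)
    rw [hd]
    exact this
  · intro e he
    obtain ⟨s, -, -, rfl⟩ := mem_seg he
    exact isSubtree_iff.1 hCU s
  · refine ⟨isSubtree_iff.2 hV.2.1, fun i hi => ?_⟩
    rw [← truncate_seq U i hi]
    exact congrArg FatEdge.val (hV.2.2 i hi)

theorem isOpen_basic {k : ℕ} (x : τ.FatSubtree k) (U : τ.FatSubtree ⊤) : IsOpen (basic x U) :=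
  TopologicalSpace.isOpen_generateFrom_of_mem ⟨k, x, U, rfl⟩

theorem basic_truncate_anti (U : τ.FatSubtree ⊤) {m m' : ℕ} (h : m ≤ m') :
    basic (U.truncate m') U ⊆ basic (U.truncate m) U := by
  rintro V ⟨h1, h2⟩
  refine ⟨h1, fun i hi => ?_⟩
  rw [h2 i (by omega), ← truncate_seq U i hi, ← truncate_seq U i (by omega)]

/-- The sets $[m,\mathbf U]$ form a neighbourhood base at $\mathbf U$: they decrease in $m$, and
transitivity of $\le$ places one inside each basic set containing $\mathbf U$. -/
theorem exists_basic_subset_of_isOpen {X : Set (τ.FatSubtree ⊤)} (hX : IsOpen X)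
    {U : τ.FatSubtree ⊤} (hU : U ∈ X) : ∃ m, basic (U.truncate m) U ⊆ X := by
  induction hX with
  | basic s hs =>
    obtain ⟨k, x, W, rfl⟩ := hs
    refine ⟨k, fun V hV => ⟨hV.1.trans hU.1, fun i hi => ?_⟩⟩
    rw [hV.2 i hi, ← truncate_seq U i hi, hU.2 i hi]
  | univ => exact ⟨0, Set.subset_univ _⟩
  | inter s t _ _ ihs iht =>
    obtain ⟨m, hm⟩ := ihs hU.1
    obtain ⟨m', hm'⟩ := iht hU.2
    exact ⟨max m m', Set.subset_inter ((basic_truncate_anti U (le_max_left _ _)).trans hm)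
      ((basic_truncate_anti U (le_max_right _ _)).trans hm')⟩
  | sUnion S _ ih =>
    obtain ⟨s, hs, hUs⟩ := hU
    obtain ⟨m, hm⟩ := ih s hs hUs
    exact ⟨m, hm.trans (Set.subset_sUnion_of_mem hs)⟩

theorem exists_cyl_subset_of_isOpen {X : Set (τ.FatSubtree ⊤)} (hX : IsOpen X) :
    ∀ W ∈ toPath '' X, τ.pathSystem.IsInf W →
      ∃ m, ∀ m' ≥ m, τ.pathSystem.cyl (seg W 0 m') W ⊆ toPath '' X := by
  rintro _ ⟨U, hU, rfl⟩ -
  obtain ⟨m, hm⟩ := exists_basic_subset_of_isOpen hX hU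
  refine ⟨m, fun m' hm' W hW => ?_⟩
  obtain ⟨V, rfl⟩ := exists_toPath_eq hW.1
  exact ⟨V, hm (basic_truncate_anti U hm' ((mem_basic_iff (truncate_seq U)).2 hW)), rfl⟩

/-- The complement of the closure is open, so it is decided by some cylinder. It cannot be avoided,
since a nonempty basic open set would then lie in the closure of `N`. -/
theorem isNull_of_isNowhereDense {N : Set (τ.FatSubtree ⊤)} (hN : IsNowhereDense N) :
    τ.pathSystem.IsNull (toPath '' N) := by
  intro U hU d y hy hs
  obtain ⟨V, hV, h⟩ := exists_near_of_open τ.pigeonhole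
    (exists_cyl_subset_of_isOpen (isClosed_closure (s := N)).isOpen_compl) hU hy hs
  refine ⟨V, hV, ?_⟩
  rcases h with h | h
  · rw [Set.eq_empty_iff_forall_notMem]
    rintro W ⟨hW, B, hB, rfl⟩
    obtain ⟨B', hB', hBB'⟩ := h hW
    rw [toPath_injective hBB'] at hB'
    exact hB' (subset_closure hB)
  · obtain ⟨W, hW⟩ := cyl_nonempty hV.1 (by rw [hV.src_eq hU le_rfl]; exact hy)
      (near_of_splice_tail hU hV y hy hs)
    obtain ⟨C, rfl⟩ := exists_toPath_eq hW.1
    obtain ⟨V, rfl⟩ := exists_toPath_eq hV.1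
    have hCy := hW.2.2
    rw [← hCy] at hW h
    have hsub : basic (C.truncate y.length) V ⊆ closure N := by
      intro B hB
      by_contra hc
      have h1 : toPath B ∈ (∅ : Set (ℕ → FatEdge τ)) := by
        rw [← h]
        exact ⟨(mem_basic_iff (truncate_seq C)).1 hB, B, hc, rfl⟩
      exact h1
    have h2 : C ∈ interior (closure N) :=
      interior_maximal hsub (isOpen_basic _ _) ((mem_basic_iff (truncate_seq C)).2 hW)
    rw [hN] at h2
    exact absurd h2 (Set.notMem_empty C)

theorem isNull_of_isMeagre {N : Set (τ.FatSubtree ⊤)} (hN : IsMeagre N) :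
    τ.pathSystem.IsNull (toPath '' N) := by
  obtain ⟨S, hS, hSc, hNS⟩ := isMeagre_iff_countable_union_isNowhereDense.1 hN
  -- The empty set is added so that an enumeration exists even when `S` is empty.
  obtain ⟨f, hf⟩ := (hSc.insert ∅).exists_eq_range (Set.insert_nonempty _ _)
  have hnd : ∀ n, IsNowhereDense (f n) := by
    intro n
    have : f n ∈ insert ∅ S := by rw [hf]; exact ⟨n, rfl⟩
    rcases this with h | h
    · rw [h]; exact isNowhereDense_empty
    · exact hS _ h
  intro U hU d y hy hs
  obtain ⟨V, hV, h⟩ := IsNull.iUnion (fun n => isNull_of_isNowhereDense (hnd n)) U hU d y hy hs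
  refine ⟨V, hV, Set.subset_empty_iff.1 ((Set.inter_subset_inter_right _ ?_).trans h.subset)⟩
  rintro _ ⟨B, hB, rfl⟩
  obtain ⟨s, hs, hBs⟩ := hNS hB
  have : s ∈ Set.range f := by rw [← hf]; exact Set.mem_insert_of_mem _ hs
  obtain ⟨n, rfl⟩ := this
  exact Set.mem_iUnion.2 ⟨n, B, hBs, rfl⟩

theorem isRamseyNull_of_isMeagre {N : Set (τ.FatSubtree ⊤)} (hN : IsMeagre N) : IsRamseyNull N := by
  intro k x U hne
  obtain ⟨d, y, hd, hy, hs, hb, hnear⟩ := exists_cyl_of_basic_nonempty hne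
  obtain ⟨W, hW, h⟩ := isNull_of_isMeagre hN _ (toPath_isInf U) d y hy hs
  obtain ⟨V, rfl⟩ := exists_toPath_eq hW.1
  refine ⟨d, hd, V, hnear V hW, ?_⟩
  rw [Set.eq_empty_iff_forall_notMem] at h ⊢
  exact fun B hB => h _ ⟨(hb B V).1 hB.1, B, hB.2, rfl⟩

/-- The cylinder is first shrunk to avoid the meager part and then to decide the open part; on what
remains, `X` and `O` coincide. -/
theorem isRamsey_of_hasBaireProperty {X : Set (τ.FatSubtree ⊤)} (hX : HasBaireProperty X) :
    IsRamsey X := by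
  obtain ⟨O, N, hO, hN, rfl⟩ := hX
  intro k x U hne
  obtain ⟨d, y, hd, hy, hs, hb, hnear⟩ := exists_cyl_of_basic_nonempty hne
  have hU := toPath_isInf U
  obtain ⟨V, hV, h⟩ := isNull_of_isMeagre hN _ hU d y hy hs
  obtain ⟨W, hW, h'⟩ := exists_near_of_open τ.pigeonhole (exists_cyl_subset_of_isOpen hO) hV.1
    (d := d) (y := y) (by rw [hV.src_eq hU le_rfl]; exact hy) (near_of_splice_tail hU hV y hy hs)
  have hUW := hV.trans hU hW le_rfl
  have hWN : ∀ B, toPath B ∈ τ.pathSystem.cyl y W → B ∉ N := fun B hB hBN => by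
    have h1 : toPath B ∈ (∅ : Set (ℕ → FatEdge τ)) := by
      rw [← h]
      exact ⟨cyl_mono hV.1 hW.1 hW.2.1 hB, B, hBN, rfl⟩
    exact h1
  obtain ⟨W, rfl⟩ := exists_toPath_eq hW.1
  refine ⟨d, hd, W, hnear W hUW, ?_⟩
  rcases h' with h' | h'
  · left
    intro B hB
    obtain ⟨B', hB', hBB'⟩ := h' ((hb B W).1 hB)
    rw [toPath_injective hBB'] at hB'
    exact Or.inl ⟨hB', hWN B ((hb B W).1 hB)⟩
  · right
    rw [Set.eq_empty_iff_forall_notMem] at h' ⊢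
    rintro B ⟨hB, hB' | hB'⟩
    · exact h' _ ⟨(hb B W).1 hB, B, hB'.1, rfl⟩
    · exact hWN B ((hb B W).1 hB) hB'.1

end SMTree.FatSubtree

end Ellentuck

theorem theorem1p10 {T A : Type*} [PartialOrder T] (τ : SMTree T A) :
    (∀ X : Set (τ.FatSubtree ⊤), HasBaireProperty X → SMTree.FatSubtree.IsRamsey X) ∧
      (∀ X : Set (τ.FatSubtree ⊤), IsMeagre X → SMTree.FatSubtree.IsRamseyNull X) :=
  ⟨fun _ h => SMTree.FatSubtree.isRamsey_of_hasBaireProperty h,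
    fun _ h => SMTree.FatSubtree.isRamseyNull_of_isMeagre h⟩
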